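/- **Theorem 3.2.** Let $r_{\max}\approx 4.8645$ be the real root of $x^3=(2x+1)^2$. Let $d\in\{2,3\}$, $L>0$, $\varepsilon>0$, $\Omega=(0,L)^d$, let $(\cdot,\cdot)$ and $\|\cdot\|$ be the $L^2(\Omega)$ inner product and norm, $f(u)=\varepsilon^{-2}(u^3-u)$ and $E[u]=\int_\Omega \tfrac12|\nabla u|^2+\tfrac1{4\varepsilon^2}(u^2-1)^2\,dx$. For $N\in\mathbb N$ let $S_N$ be the space of real-valued functions in the complex span of the modes $e^{2\pi i k\cdot x/L}$, $k\in\mathbb Z^d$, $-\frac N2\le k_j\le \frac N2-1$, and let $P_N$ be the $L^2(\Omega)$-orthogonal projection onto $S_N$. Given a mesh $0=t_0<t_1<\dots<t_K$, put $\tau_k=t_k-t_{k-1}$, $r_1=0$, $r_k=\tau_k/\tau_{k-1}$ $(k\ge2)$, $$\mathcal D_2u^n=\tfrac{1+2r_n}{\tau_n(1+r_n)}(u^n-u^{n-1})-\tfrac{r_n^2}{\tau_n(1+r_n)}(u^{n-1}-u^{n-2})\ (n\ge 2),\qquad \mathcal D_2u^1=\tfrac{u^1-u^0}{\tau_1},$$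 $Bu^0=u^0$ and $Bu^{n-1}=(1+r_n)u^{n-1}-r_nu^{n-2}$ $(n\ge2)$. Let $\Phi^0\in L^2(\Omega)$ be real-valued. The scheme starts from $\bar\phi^0=\phi^0=P_N\Phi^0$, $\gamma^0=E[\phi^0]+1$, and for $1\le n\le K$ determines $\bar\phi^n\in S_N$, $\gamma^n,\xi^n,\eta^n\in\mathbb R$ and $\phi^n\in S_N$ by $$(\mathcal D_2\bar\phi^n,v)+(\Delta^2\bar\phi^n,v)-(\Delta f(B\phi^{n-1}),v)=0\quad\forall v\in S_N,$$ $$\frac{\gamma^n-\gamma^{n-1}}{\tau_n}=-\frac{\gamma^n}{E[\bar\phi^n]+1}\,\|-\nabla\Delta\bar\phi^n+\nabla f(B\phi^{n-1})\|^2,\qquad \xi^n=\frac{\gamma^n}{E[\bar\phi^n]+1},$$ $$\eta^n=1-(1-\xi^n)^2,\qquad \phi^n=\eta^n\bar\phi^n .$$ Put $$M=2\gamma^0(\gamma^0+2)\sqrt{1+|\Omega|^{1/2}\sqrt{2\varepsilon^2+|\Omega|}},\qquad c_1=2(1+r_{\max})^3r_{\max}(\gamma^0)^2(2+\gamma^0)^2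 .$$ Then for every $\delta\in(0,r_{\max})$ there is a constant $c_\delta>0$ depending only on $\delta$, and for every $\epsilon>0$ a constant $C(\epsilon,M)>0$ depending only on $\epsilon$, $M$ and the fixed data $d,L,\varepsilon$ of the problem (in particular not on $\delta$, $N$, $K$ or the mesh), such that the following holds. If the mesh satisfies **(A1)** $\ 0<r_k\le r_{\max}-\delta$ for $2\le k\le K$, then every solution of the scheme satisfies, for every $\epsilon>0$ and every $1\le n\le K$, $$\|\Delta\bar\phi^n\|^2+\Big(\frac{c_\delta}2-\frac{40\,\epsilon\, c_1}{\delta}\Big)\sum_{k=1}^{n-1}\tau_k\|\Delta^2\bar\phi^k\|^2\le\|\Delta\bar\phi^0\|^2+\frac{80(1+r_{\max})^3\epsilon\,\tau_1}{\delta}\|\Delta^2\phi^0\|^2+\frac{C(\epsilon,M)\,t_n}{\delta}.$$ -/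

import Mathlib

open MeasureTheory

noncomputable section

namespace CahnHilliard

/-! ### Variable time meshes, BDF kernels and extrapolation -/

/-- The time step `τ_k = t_k - t_{k-1}` (used for `k ≥ 1`). -/
def step (t : ℕ → ℝ) (k : ℕ) : ℝ := t k - t (k - 1)

/-- The adjacent step ratio `r_k = τ_k / τ_{k-1}` for `k ≥ 2`, and `r_1 = 0`. -/
def ratio (t : ℕ → ℝ) (k : ℕ) : ℝ := if k ≤ 1 then 0 else step t k / step t (k - 1)

/-- A time mesh `0 = t_0 < t_1 < ⋯ < t_K`. -/
structure IsTimeMesh (K : ℕ) (t : ℕ → ℝ) : Prop where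
  zero : t 0 = 0
  lt : ∀ k, 1 ≤ k → k ≤ K → t (k - 1) < t k

/-- Step ratio condition A1: `0 < r_k ≤ r_max - δ` for `2 ≤ k ≤ K`. -/
def StepRatioCond (rmax δ : ℝ) (K : ℕ) (t : ℕ → ℝ) : Prop :=
  ∀ k, 2 ≤ k → k ≤ K → 0 < ratio t k ∧ ratio t k ≤ rmax - δ

/-- The BDF2 convolution kernels `b_j^{(n)}` on the mesh `t`
(for `n = 1` this is BDF1, because `r_1 = 0`). -/
def bdfKernel (t : ℕ → ℝ) (n : ℕ) : ℕ → ℝ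
  | 0 => (1 + 2 * ratio t n) / (step t n * (1 + ratio t n))
  | 1 => -(ratio t n) ^ 2 / (step t n * (1 + ratio t n))
  | _ + 2 => 0

/-- `D₂ u^n = ∑_{k=1}^n b_{n-k}^{(n)} (u^k - u^{k-1})`, for `n ≥ 1`. -/
def bdf2 {V : Type*} [AddCommGroup V] [Module ℝ V] (t : ℕ → ℝ) (u : ℕ → V) (n : ℕ) : V :=
  ∑ k ∈ Finset.Icc 1 n, bdfKernel t n (n - k) • (u k - u (k - 1))

/-- The extrapolation `B u^m`: `B u^0 = u^0` and
`B u^{n-1} = (1 + r_n) u^{n-1} - r_n u^{n-2}` for `n ≥ 2`. -/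
def extrap {V : Type*} [AddCommGroup V] [Module ℝ V] (t : ℕ → ℝ) (u : ℕ → V) : ℕ → V
  | 0 => u 0
  | m + 1 => (1 + ratio t (m + 2)) • u (m + 1) - ratio t (m + 2) • u m

/-! ### Functions on the periodic box -/

/-- The space `ℝ^d`. -/
abbrev Space (d : ℕ) : Type := EuclideanSpace ℝ (Fin d)

/-- The box `Ω = (0, L)^d`. -/
def box (d : ℕ) (L : ℝ) : Set (Space d) := {x | ∀ i, x i ∈ Set.Ioo 0 L}

/-- The `L²(Ω)` inner product of real functions. -/
def l2inner (d : ℕ) (L : ℝ) (u v : Space d → ℝ) : ℝ := ∫ x in box d L, u x * v x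

/-- The squared `L²(Ω)` norm of a scalar or vector valued function. -/
def l2normSq (d : ℕ) (L : ℝ) {F : Type*} [NormedAddCommGroup F] (u : Space d → F) : ℝ :=
  ∫ x in box d L, ‖u x‖ ^ 2

/-- The classical Laplacian of a function on `ℝ^d`. -/
def lap {d : ℕ} (u : Space d → ℝ) : Space d → ℝ := Laplacian.laplacian u

/-- The gradient of a function on `ℝ^d`. -/
def grad {d : ℕ} (u : Space d → ℝ) : Space d → Space d := fun x => gradient u x

/-- The Fourier mode `exp(i ∑_j (2π k_j / L) x_j)`. -/
def fourierMode (d : ℕ) (L : ℝ) (k : Fin d → ℤ) : Space d → ℂ := fun x =>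
  Complex.exp (Complex.I * ((∑ j, 2 * Real.pi * (k j : ℝ) / L * x j : ℝ) : ℂ))

/-- The Fourier space `S_N`: the real valued functions in the complex span of the modes with
`-N/2 ≤ k_j ≤ N/2 - 1` for every `j`. -/
def fourierSpace (d : ℕ) (L : ℝ) (N : ℕ) : Set (Space d → ℝ) :=
  {u | (fun x => (u x : ℂ)) ∈ Submodule.span ℂ
    (fourierMode d L '' {k | ∀ j, -(N : ℤ) ≤ 2 * k j ∧ 2 * k j ≤ (N : ℤ) - 2})}

/-! ### The Cahn-Hilliard energy and the scheme -/

/-- The nonlinearity `f(u) = (u³ - u) / ε²`. -/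
def nonlin (ε : ℝ) {d : ℕ} (u : Space d → ℝ) : Space d → ℝ := fun x => (u x ^ 3 - u x) / ε ^ 2

/-- The energy `E[u] = ∫_Ω ½ |∇u|² + (u² - 1)² / (4 ε²)`. -/
def energy (d : ℕ) (L ε : ℝ) (u : Space d → ℝ) : ℝ :=
  ∫ x in box d L, ((1 / 2) * ‖grad u x‖ ^ 2 + (u x ^ 2 - 1) ^ 2 / (4 * ε ^ 2))

/-- `(φbar, φ, γ, ξ, η)` is a solution, for the levels `0, …, K` of the time mesh `t`, of the
IMEX BDF2 generalized SAV Fourier spectral scheme with initial function `Φ₀`. -/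
structure IsSchemeSolution (d : ℕ) (L ε : ℝ) (N K : ℕ) (t : ℕ → ℝ) (Φ₀ : Space d → ℝ)
    (φbar φ : ℕ → Space d → ℝ) (γ ξ η : ℕ → ℝ) : Prop where
  /-- all levels lie in the discrete space -/
  mem : ∀ n, n ≤ K → φbar n ∈ fourierSpace d L N
  /-- `φbar^0 = P_N Φ₀`, the `L²` orthogonal projection -/
  init_proj : ∀ v ∈ fourierSpace d L N, l2inner d L (fun x => φbar 0 x - Φ₀ x) v = 0
  init_eq : φ 0 = φbar 0
  init_gamma : γ 0 = energy d L ε (φ 0) + 1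
  /-- `(D₂ φbar^n, v) + (Δ² φbar^n, v) - (Δ f(B φ^{n-1}), v) = 0` for `v ∈ S_N` -/
  weak_eq : ∀ n, 1 ≤ n → n ≤ K → ∀ v ∈ fourierSpace d L N,
    l2inner d L (bdf2 t φbar n) v + l2inner d L (lap (lap (φbar n))) v
      - l2inner d L (lap (nonlin ε (extrap t φ (n - 1)))) v = 0
  /-- `(γ^n - γ^{n-1}) / τ_n = - γ^n / (E(φbar^n) + 1) ‖-∇Δ φbar^n + ∇f(B φ^{n-1})‖²` -/
  gamma_eq : ∀ n, 1 ≤ n → n ≤ K →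
    (γ n - γ (n - 1)) / step t n =
      -(γ n / (energy d L ε (φbar n) + 1)) *
        l2normSq d L (fun x => -grad (lap (φbar n)) x
          + grad (nonlin ε (extrap t φ (n - 1))) x)
  xi_eq : ∀ n, 1 ≤ n → n ≤ K → ξ n = γ n / (energy d L ε (φbar n) + 1)
  eta_eq : ∀ n, 1 ≤ n → n ≤ K → η n = 1 - (1 - ξ n) ^ 2
  phi_eq : ∀ n, 1 ≤ n → n ≤ K → φ n = η n • φbar n

/-- The a priori `H¹` bound
`M = 2 γ⁰ (γ⁰ + 2) √(1 + c² √(2 ε² + |Ω|))` of the scheme, where `|Ω| = L^d` and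
`c = |Ω|^{1/4}` is the best constant in `‖u‖_{L²} ≤ c ‖u‖_{L⁴}`. -/
def h1Bound (d : ℕ) (L ε γ₀ : ℝ) : ℝ :=
  2 * γ₀ * (γ₀ + 2) *
    Real.sqrt (1 + ((L ^ d) ^ (1 / 4 : ℝ)) ^ 2 * Real.sqrt (2 * ε ^ 2 + L ^ d))

/-- `c₁ = 2 (1 + r_max)³ r_max (γ⁰)² (2 + γ⁰)²`. -/
def constC1 (rmax γ₀ : ℝ) : ℝ := 2 * (1 + rmax) ^ 3 * rmax * γ₀ ^ 2 * (2 + γ₀) ^ 2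

end CahnHilliard

end

open CahnHilliard

noncomputable section

namespace CahnHilliard

/-! ### Trigonometric polynomials as finitely supported coefficient families -/

/-! Everything in the scheme is a trigonometric polynomial, so the proof works with Fourier
coefficients. `TrigPoly.eval` is an algebra homomorphism, hence `f` acts through convolution powers,
`Δ` is a real multiplier, and Parseval (`Represents.l2inner_eq`) turns each norm into `L ^ d` times
a weighted `ℓ²` sum.

The time-stepping estimate is abstract (`bdf2_energy_stability`). Write `g n = u n - u (n - 1)`, `D
n = ‖g n‖² / τ_n` and `q = R (R + 1)³`. Testing with `g n` makes the bilaplacian produce a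
telescoping difference of `‖Δu‖²`. By Young's inequality `2 (D₂u, g n)` is at least `(μ + δ/q) D n -
μ D (n - 1)` with `μ = (2R + 1)/(R + 1)`: the `μ` terms telescope and a surplus proportional to `δ`
remains. Testing with `Δ²u` then recovers `∑ τ ‖Δ²u‖²` from `∑ D` and the forcing `F = Δ f(Bφ)`.

The forcing is controlled by `exists_weightedSq_nonlinCoeff_le`: `‖Δf(v)‖² ≤ η ‖Δ²v‖² + C`, where
`C` depends on an `H¹` bound of `v`. In the Wiener norm the cube obeys `‖Δ(v³)‖ ≲ ‖v‖_W² ‖Δv‖`. An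
Agmon-type bound gives `‖v‖_W² ≤ s ‖Δv‖² + C ‖v‖²` with `s` as small as desired, and `‖Δv‖⁶ ≤ ‖∇v‖⁴
‖Δ²v‖²` absorbs the resulting critical term.

The `H¹` bound comes from the auxiliary variable: `0 < γ n ≤ γ 0` yields `|η| (E[φbar] + 1) ≤ γ 0 (2
+ γ 0)` (`abs_eta_le`), so `φ = η φbar` is bounded in `H¹` although no such bound is asserted for
`φbar`. The same inequality bounds `|η|` and converts `‖Δ²φ‖` into `‖Δ²φbar‖`, which produces `c₁`.
Since the extrapolation only looks backwards, the forcing sum stops at `n - 1` and level zero enters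
with weight `τ_1`. -/

/-- Formal trigonometric polynomials on the `d`-dimensional torus. -/
abbrev TrigPoly (d : ℕ) : Type := AddMonoidAlgebra ℂ (Fin d → ℤ)

namespace TrigPoly

variable {d : ℕ}

/-- The `ℓ¹` norm of the coefficients. -/
def wienerNorm (a : TrigPoly d) : ℝ := ∑ k ∈ a.coeff.support, ‖a.coeff k‖

/-- The weighted squared `ℓ²` norm of the coefficients. -/
def weightedSq (w : (Fin d → ℤ) → ℝ) (a : TrigPoly d) : ℝ :=
  ∑ k ∈ a.coeff.support, w k * ‖a.coeff k‖ ^ 2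

lemma wienerNorm_nonneg (a : TrigPoly d) : 0 ≤ wienerNorm a :=
  Finset.sum_nonneg fun _ _ => norm_nonneg _

lemma weightedSq_nonneg {w : (Fin d → ℤ) → ℝ} (hw : ∀ k, 0 ≤ w k) (a : TrigPoly d) :
    0 ≤ weightedSq w a :=
  Finset.sum_nonneg fun k _ => mul_nonneg (hw k) (sq_nonneg _)

lemma weightedSq_eq_sum (w : (Fin d → ℤ) → ℝ) (a : TrigPoly d) {s : Finset (Fin d → ℤ)}
    (hs : a.coeff.support ⊆ s) : weightedSq w a = ∑ k ∈ s, w k * ‖a.coeff k‖ ^ 2 := by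
  refine Finset.sum_subset hs fun k _ hk => ?_
  simp [Finsupp.notMem_support_iff.1 hk]

lemma wienerNorm_eq_sum (a : TrigPoly d) {s : Finset (Fin d → ℤ)}
    (hs : a.coeff.support ⊆ s) : wienerNorm a = ∑ k ∈ s, ‖a.coeff k‖ := by
  refine Finset.sum_subset hs fun k _ hk => ?_
  simp [Finsupp.notMem_support_iff.1 hk]

lemma sum_le_wienerNorm (a : TrigPoly d) (s : Finset (Fin d → ℤ)) :
    ∑ k ∈ s, ‖a.coeff k‖ ≤ wienerNorm a := by
  classical
  rw [wienerNorm_eq_sum a (s := a.coeff.support ∪ s) Finset.subset_union_left]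
  exact Finset.sum_le_sum_of_subset_of_nonneg Finset.subset_union_right
    fun _ _ _ => norm_nonneg _

lemma sum_le_weightedSq {w : (Fin d → ℤ) → ℝ} (hw : ∀ k, 0 ≤ w k) (a : TrigPoly d)
    (s : Finset (Fin d → ℤ)) :
    ∑ k ∈ s, w k * ‖a.coeff k‖ ^ 2 ≤ weightedSq w a := by
  classical
  rw [weightedSq_eq_sum w a (s := a.coeff.support ∪ s) Finset.subset_union_left]
  exact Finset.sum_le_sum_of_subset_of_nonneg Finset.subset_union_right
    fun k _ _ => mul_nonneg (hw k) (sq_nonneg _)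

lemma weightedSq_add_le {w : (Fin d → ℤ) → ℝ} (hw : ∀ k, 0 ≤ w k) (a b : TrigPoly d) :
    weightedSq w (a + b) ≤ 2 * weightedSq w a + 2 * weightedSq w b := by
  classical
  have hs := Finsupp.support_add (g₁ := a.coeff) (g₂ := b.coeff)
  rw [weightedSq_eq_sum w (a + b) (s := a.coeff.support ∪ b.coeff.support) hs,
    weightedSq_eq_sum w a (s := a.coeff.support ∪ b.coeff.support) Finset.subset_union_left,
    weightedSq_eq_sum w b (s := a.coeff.support ∪ b.coeff.support) Finset.subset_union_right,
    Finset.mul_sum, Finset.mul_sum, ← Finset.sum_add_distrib]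
  refine Finset.sum_le_sum fun k _ => ?_
  have h1 : ‖(a + b).coeff k‖ ≤ ‖a.coeff k‖ + ‖b.coeff k‖ := norm_add_le _ _
  have h2 : ‖(a + b).coeff k‖ ^ 2 ≤ 2 * ‖a.coeff k‖ ^ 2 + 2 * ‖b.coeff k‖ ^ 2 := by
    nlinarith [sq_nonneg (‖a.coeff k‖ - ‖b.coeff k‖), norm_nonneg ((a + b).coeff k),
      norm_nonneg (a.coeff k), norm_nonneg (b.coeff k)]
  nlinarith [mul_le_mul_of_nonneg_left h2 (hw k)]

lemma weightedSq_smul (w : (Fin d → ℤ) → ℝ) (c : ℂ) (a : TrigPoly d) :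
    weightedSq w (c • a) = ‖c‖ ^ 2 * weightedSq w a := by
  have hs : (c • a).coeff.support ⊆ a.coeff.support := Finsupp.support_smul
  rw [weightedSq_eq_sum w _ hs, weightedSq, Finset.mul_sum]
  refine Finset.sum_congr rfl fun k _ => ?_
  simp only [AddMonoidAlgebra.coeff_smul, Finsupp.smul_apply, smul_eq_mul, norm_mul]
  ring

lemma coeff_mul_eq_sum (a b : TrigPoly d) (k : Fin d → ℤ) :
    (a * b).coeff k = ∑ i ∈ a.coeff.support, a.coeff i * b.coeff (k - i) := by
  rw [AddMonoidAlgebra.coeff_mul_apply_left]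
  simp [Finsupp.sum, sub_eq_neg_add]

/-- Young's convolution inequality `ℓ¹ * ℓ² ⊆ ℓ²`. -/
lemma sum_conv_sq_le_of_left {G : Type*} [AddCommGroup G] (s S : Finset G) {α β : G → ℝ} {B : ℝ}
    (hα : ∀ i, 0 ≤ α i) (hB : ∀ S' : Finset G, ∑ k ∈ S', β k ^ 2 ≤ B) :
    ∑ k ∈ S, (∑ i ∈ s, α i * β (k - i)) ^ 2 ≤ (∑ i ∈ s, α i) ^ 2 * B := by
  have h1 : ∀ k ∈ S, (∑ i ∈ s, α i * β (k - i)) ^ 2 ≤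
      (∑ i ∈ s, α i) * ∑ i ∈ s, α i * β (k - i) ^ 2 := fun k _ =>
    Finset.sum_sq_le_sum_mul_sum_of_sq_le_mul s (fun i _ => hα i)
      (fun i _ => mul_nonneg (hα i) (sq_nonneg _)) (fun i _ => le_of_eq (by ring))
  refine (Finset.sum_le_sum h1).trans ?_
  rw [← Finset.mul_sum, Finset.sum_comm, sq, mul_assoc]
  refine mul_le_mul_of_nonneg_left ?_ (Finset.sum_nonneg fun i _ => hα i)
  rw [Finset.sum_mul]
  refine Finset.sum_le_sum fun i _ => ?_
  rw [← Finset.mul_sum]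
  refine mul_le_mul_of_nonneg_left ?_ (hα i)
  have := hB (S.map (Equiv.subRight i).toEmbedding)
  simpa using this

/-- Young's convolution inequality `ℓ² * ℓ¹ ⊆ ℓ²`. -/
lemma sum_conv_sq_le_of_right {G : Type*} [AddCommGroup G] (s S : Finset G) {α β : G → ℝ}
    {B : ℝ} (hβ : ∀ i, 0 ≤ β i)
    (hB : ∀ S' : Finset G, ∑ k ∈ S', β k ≤ B) :
    ∑ k ∈ S, (∑ i ∈ s, α i * β (k - i)) ^ 2 ≤ B ^ 2 * ∑ i ∈ s, α i ^ 2 := by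
  classical
  have hB0 : 0 ≤ B := by simpa using hB ∅
  have h1 : ∀ k ∈ S, (∑ i ∈ s, α i * β (k - i)) ^ 2 ≤
      B * ∑ i ∈ s, α i ^ 2 * β (k - i) := fun k _ => by
    refine (Finset.sum_sq_le_sum_mul_sum_of_sq_le_mul s (fun i _ => hβ (k - i))
      (fun i _ => mul_nonneg (sq_nonneg (α i)) (hβ _)) (fun i _ => le_of_eq (by ring))).trans ?_
    refine mul_le_mul_of_nonneg_right ?_
      (Finset.sum_nonneg fun i _ => mul_nonneg (sq_nonneg _) (hβ _))
    have := hB (s.map (Equiv.subLeft k).toEmbedding)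
    simpa using this
  refine (Finset.sum_le_sum h1).trans ?_
  rw [← Finset.mul_sum, Finset.sum_comm, sq, mul_assoc]
  refine mul_le_mul_of_nonneg_left ?_ hB0
  rw [Finset.mul_sum]
  refine Finset.sum_le_sum fun i _ => ?_
  rw [← Finset.mul_sum, mul_comm]
  refine mul_le_mul_of_nonneg_right ?_ (sq_nonneg _)
  have := hB (S.map (Equiv.subRight i).toEmbedding)
  simpa using this

lemma wienerNorm_mul_le (a b : TrigPoly d) :
    wienerNorm (a * b) ≤ wienerNorm a * wienerNorm b := by
  have h1 : ∀ k ∈ (a * b).coeff.support, ‖(a * b).coeff k‖ ≤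
      ∑ i ∈ a.coeff.support, ‖a.coeff i‖ * ‖b.coeff (k - i)‖ := fun k _ => by
    rw [coeff_mul_eq_sum]
    refine (norm_sum_le _ _).trans (le_of_eq ?_)
    simp
  refine (Finset.sum_le_sum h1).trans ?_
  rw [Finset.sum_comm, wienerNorm, Finset.sum_mul]
  refine Finset.sum_le_sum fun i _ => ?_
  rw [← Finset.mul_sum]
  refine mul_le_mul_of_nonneg_left ?_ (norm_nonneg _)
  have := sum_le_wienerNorm b ((a * b).coeff.support.map (Equiv.subRight i).toEmbedding)
  simpa using this

/-- Quasi-subadditivity of the symbol replaces the Leibniz rule: in `a i * b (k - i)` the weight `q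
k` can be moved onto one factor at a time, and Young's inequality keeps the other factor in `ℓ¹`.
The 8 is from `(2x + 2y)² ≤ 8x² + 8y²`. -/
lemma weightedSq_mul_le {q : (Fin d → ℤ) → ℝ} (hq : ∀ k, 0 ≤ q k)
    (hadd : ∀ i j, q (i + j) ≤ 2 * q i + 2 * q j) (a b : TrigPoly d) :
    weightedSq (fun k => q k ^ 2) (a * b) ≤
      8 * (weightedSq (fun k => q k ^ 2) a * wienerNorm b ^ 2 +
        wienerNorm a ^ 2 * weightedSq (fun k => q k ^ 2) b) := by
  have h1 : ∀ k ∈ (a * b).coeff.support, q k ^ 2 * ‖(a * b).coeff k‖ ^ 2 ≤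
      8 * (∑ i ∈ a.coeff.support, (q i * ‖a.coeff i‖) * ‖b.coeff (k - i)‖) ^ 2 +
      8 * (∑ i ∈ a.coeff.support, ‖a.coeff i‖ * (q (k - i) * ‖b.coeff (k - i)‖)) ^ 2 := by
    intro k _
    have h2 : q k * ‖(a * b).coeff k‖ ≤
        2 * (∑ i ∈ a.coeff.support, (q i * ‖a.coeff i‖) * ‖b.coeff (k - i)‖) +
        2 * (∑ i ∈ a.coeff.support, ‖a.coeff i‖ * (q (k - i) * ‖b.coeff (k - i)‖)) := by
      rw [coeff_mul_eq_sum]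
      refine (mul_le_mul_of_nonneg_left (norm_sum_le _ _) (hq k)).trans ?_
      rw [Finset.mul_sum, Finset.mul_sum, Finset.mul_sum, ← Finset.sum_add_distrib]
      refine Finset.sum_le_sum fun i _ => ?_
      have h3 : q k ≤ 2 * q i + 2 * q (k - i) := by simpa using hadd i (k - i)
      rw [norm_mul]
      have := mul_le_mul_of_nonneg_right h3
        (mul_nonneg (norm_nonneg (a.coeff i)) (norm_nonneg (b.coeff (k - i))))
      linarith
    have h0 : 0 ≤ q k * ‖(a * b).coeff k‖ := mul_nonneg (hq k) (norm_nonneg _)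
    rw [← mul_pow]
    have := pow_le_pow_left₀ h0 h2 2
    nlinarith [sq_nonneg ((∑ i ∈ a.coeff.support, (q i * ‖a.coeff i‖) * ‖b.coeff (k - i)‖) -
      (∑ i ∈ a.coeff.support, ‖a.coeff i‖ * (q (k - i) * ‖b.coeff (k - i)‖)))]
  refine (Finset.sum_le_sum h1).trans ?_
  rw [Finset.sum_add_distrib, ← Finset.mul_sum, ← Finset.mul_sum]
  have e1 := sum_conv_sq_le_of_right a.coeff.support (a * b).coeff.support
    (α := fun i => q i * ‖a.coeff i‖) (β := fun i => ‖b.coeff i‖)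
    (fun _ => norm_nonneg _) (sum_le_wienerNorm b)
  have e2 := sum_conv_sq_le_of_left a.coeff.support (a * b).coeff.support
    (α := fun i => ‖a.coeff i‖) (β := fun i => q i * ‖b.coeff i‖)
    (B := weightedSq (fun k => q k ^ 2) b) (fun _ => norm_nonneg _)
    (fun S => by
      simpa only [mul_pow] using sum_le_weightedSq (fun k => sq_nonneg (q k)) b S)
  simp only [mul_pow] at e1
  have e3 : ∑ i ∈ a.coeff.support, q i ^ 2 * ‖a.coeff i‖ ^ 2 =
    weightedSq (fun k => q k ^ 2) a := rfl
  have e4 : ∑ i ∈ a.coeff.support, ‖a.coeff i‖ = wienerNorm a := rfl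
  rw [e3] at e1
  rw [e4] at e2
  linarith

/-- Apply the product estimate to `a * a` and then to `(a * a) * a`; `136 = 8 * (16 + 1)`. -/
lemma weightedSq_cube_le {q : (Fin d → ℤ) → ℝ} (hq : ∀ k, 0 ≤ q k)
    (hadd : ∀ i j, q (i + j) ≤ 2 * q i + 2 * q j) (a : TrigPoly d) :
    weightedSq (fun k => q k ^ 2) (a ^ 3) ≤
      136 * (wienerNorm a ^ 2) ^ 2 * weightedSq (fun k => q k ^ 2) a := by
  have hX := weightedSq_nonneg (fun k => sq_nonneg (q k)) a
  have h1 := weightedSq_mul_le hq hadd a a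
  have h2 := weightedSq_mul_le hq hadd (a * a) a
  have h3 := pow_le_pow_left₀ (wienerNorm_nonneg _) (wienerNorm_mul_le a a) 2
  have h4 := mul_le_mul_of_nonneg_right h1 (sq_nonneg (wienerNorm a))
  have h5 := mul_le_mul_of_nonneg_right h3 hX
  have : a ^ 3 = a * a * a := by ring
  rw [this]
  refine h2.trans ?_
  nlinarith

/-- `(∑ q² |a|²)³ ≤ (∑ q |a|²)² ∑ q⁴ |a|²`. -/
lemma weightedSq_interpolation {q : (Fin d → ℤ) → ℝ} (hq : ∀ k, 0 ≤ q k) (a : TrigPoly d) :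
    weightedSq (fun k => q k ^ 2) a ^ 3 ≤
      weightedSq q a ^ 2 * weightedSq (fun k => q k ^ 4) a := by
  have hn : ∀ (m : ℕ) (k : Fin d → ℤ), 0 ≤ q k ^ m := fun m k => pow_nonneg (hq k) m
  -- Cauchy–Schwarz between neighbouring exponents, twice; the third-power sum is then eliminated
  -- and one factor `X2` cancelled.
  have h1 : weightedSq (fun k => q k ^ 2) a ^ 2 ≤
      weightedSq q a * weightedSq (fun k => q k ^ 3) a :=
    Finset.sum_sq_le_sum_mul_sum_of_sq_le_mul _
      (fun k _ => mul_nonneg (hq k) (sq_nonneg _))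
      (fun k _ => mul_nonneg (hn 3 k) (sq_nonneg _)) (fun k _ => le_of_eq (by ring))
  have h2 : weightedSq (fun k => q k ^ 3) a ^ 2 ≤
      weightedSq (fun k => q k ^ 2) a * weightedSq (fun k => q k ^ 4) a :=
    Finset.sum_sq_le_sum_mul_sum_of_sq_le_mul _
      (fun k _ => mul_nonneg (hn 2 k) (sq_nonneg _))
      (fun k _ => mul_nonneg (hn 4 k) (sq_nonneg _)) (fun k _ => le_of_eq (by ring))
  have p1 := weightedSq_nonneg hq a
  have p2 := weightedSq_nonneg (hn 2) a
  have p3 := weightedSq_nonneg (hn 3) a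
  have p4 := weightedSq_nonneg (hn 4) a
  set X1 := weightedSq q a
  set X2 := weightedSq (fun k => q k ^ 2) a
  set X3 := weightedSq (fun k => q k ^ 3) a
  set X4 := weightedSq (fun k => q k ^ 4) a
  rcases p2.eq_or_lt with h | h
  · rw [← h]
    simpa using mul_nonneg (sq_nonneg X1) p4
  · have h3 : X2 ^ 2 * X2 ^ 2 ≤ X1 ^ 2 * (X2 * X4) := by
      calc X2 ^ 2 * X2 ^ 2 ≤ (X1 * X3) * (X1 * X3) := by gcongr
        _ = X1 ^ 2 * X3 ^ 2 := by ring
        _ ≤ _ := by gcongr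
    refine le_of_mul_le_mul_left ?_ h
    linarith

end TrigPoly
end CahnHilliard

/-! ### Lattice sums, an Agmon inequality and the bound on the nonlinearity -/

namespace CahnHilliard

/-- The squared Euclidean length of the frequency `2πk/L`. -/
def freqSq {d : ℕ} (L : ℝ) (k : Fin d → ℤ) : ℝ := ∑ j, (2 * Real.pi * (k j : ℝ) / L) ^ 2

lemma freqSq_nonneg {d : ℕ} (L : ℝ) (k : Fin d → ℤ) : 0 ≤ freqSq L k :=
  Finset.sum_nonneg fun _ _ => sq_nonneg _

lemma freqSq_add_le {d : ℕ} (L : ℝ) (i j : Fin d → ℤ) :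
    freqSq L (i + j) ≤ 2 * freqSq L i + 2 * freqSq L j := by
  unfold freqSq
  rw [Finset.mul_sum, Finset.mul_sum, ← Finset.sum_add_distrib]
  refine Finset.sum_le_sum fun l _ => ?_
  have : 2 * Real.pi * ((i + j) l : ℤ) / L = 2 * Real.pi * (i l : ℝ) / L +
      2 * Real.pi * (j l : ℝ) / L := by
    rw [Pi.add_apply, Int.cast_add]; ring
  rw [this]
  nlinarith [sq_nonneg (2 * Real.pi * (i l : ℝ) / L - 2 * Real.pi * (j l : ℝ) / L)]

/-- The lattice `ℤ^d` has rank below 4. This is where the restriction on the dimension is needed. -/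
lemma summable_int_norm_inv_pow_four {d : ℕ} (hd : d ≤ 3) :
    Summable fun k : Fin d → ℤ => ‖(fun j => (k j : ℝ) : Fin d → ℝ)‖⁻¹ ^ 4 := by
  let Λ := Submodule.span ℤ (Set.range (Pi.basisFun ℝ (Fin d)))
  have hrank : Module.finrank ℤ Λ < 4 := by
    have : Module.finrank ℤ Λ = Module.finrank ℝ (Fin d → ℝ) := ZLattice.rank ℝ Λ
    rw [this, Module.finrank_fin_fun]
    omega
  have hs := ZLattice.summable_norm_pow_inv Λ 4 hrank
  have hmem : ∀ k : Fin d → ℤ, (fun j => (k j : ℝ) : Fin d → ℝ) ∈ Λ := fun k => by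
    rw [(Pi.basisFun ℝ (Fin d)).mem_span_iff_repr_mem ℤ]
    intro i
    exact ⟨k i, by simp⟩
  have hinj : Function.Injective
      (fun k : Fin d → ℤ => (⟨fun j => (k j : ℝ), hmem k⟩ : Λ)) := fun k k' h => by
    funext j
    have h' : (k j : ℝ) = (k' j : ℝ) := congrFun (Subtype.ext_iff.1 h) j
    exact_mod_cast h'
  exact (hs.comp_injective hinj).congr fun k => rfl

lemma freqSq_ge {d : ℕ} {L : ℝ} (hL : 0 < L) (k : Fin d → ℤ) :
    (2 * Real.pi / L) ^ 2 * ‖(fun j => (k j : ℝ) : Fin d → ℝ)‖ ^ 2 ≤ freqSq L k := by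
  have h : ∀ j, (2 * Real.pi / L) ^ 2 * (k j : ℝ) ^ 2 ≤ freqSq L k := fun j => by
    have := Finset.single_le_sum (f := fun j => (2 * Real.pi * (k j : ℝ) / L) ^ 2)
      (fun _ _ => sq_nonneg _) (Finset.mem_univ j)
    refine le_trans (le_of_eq ?_) this
    ring
  have hA : 0 < (2 * Real.pi / L) ^ 2 := by positivity
  rw [← le_div_iff₀' hA]
  refine (Real.le_sqrt (norm_nonneg _) (div_nonneg (freqSq_nonneg L k) hA.le)).1 ?_
  rw [pi_norm_le_iff_of_nonneg (Real.sqrt_nonneg _)]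
  intro j
  refine Real.le_sqrt_of_sq_le ?_
  rw [le_div_iff₀' hA, Real.norm_eq_abs, sq_abs]
  exact h j

lemma summable_one_div_freqSq {d : ℕ} (hd : d ≤ 3) {L η : ℝ} (hL : 0 < L) (hη : 0 < η) :
    Summable fun k : Fin d → ℤ => 1 / (η * freqSq L k ^ 2 + 1) := by
  have hA : 0 < 2 * Real.pi / L := by positivity
  refine Summable.of_norm_bounded_eventually
    ((summable_int_norm_inv_pow_four hd).mul_left (1 / (η * (2 * Real.pi / L) ^ 4))) ?_
  -- The comparison is only made for `k ≠ 0`: at the origin the inverse norm is `0` in Lean.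
  refine (Set.finite_singleton (0 : Fin d → ℤ)).subset fun k hk => ?_
  by_contra h0
  apply hk
  have hpos : 0 < ‖(fun j => (k j : ℝ) : Fin d → ℝ)‖ := by
    rw [norm_pos_iff]
    intro h
    apply h0
    funext j
    have h' : (k j : ℝ) = 0 := congrFun h j
    exact_mod_cast h'
  have h1 := pow_le_pow_left₀ (by positivity) (freqSq_ge hL k) 2
  change ‖_‖ ≤ _
  rw [Real.norm_of_nonneg (by positivity), inv_pow, ← one_div,
    div_mul_div_comm, one_mul]
  refine one_div_le_one_div_of_le (by positivity) ?_
  have := mul_le_mul_of_nonneg_left h1 hη.le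
  refine le_trans (le_of_eq ?_) (this.trans (le_add_of_nonneg_right zero_le_one))
  ring

/-- By dominated convergence the full series tends to `0` as `C → ∞`. Reaching the bound 1 for every
`η` is what allows an arbitrarily small `H²` coefficient in the Agmon inequality. -/
lemma exists_sum_one_div_freqSq_le {d : ℕ} (hd : d ≤ 3) {L η : ℝ} (hL : 0 < L) (hη : 0 < η) :
    ∃ C : ℝ, 0 < C ∧ ∀ s : Finset (Fin d → ℤ),
      ∑ k ∈ s, 1 / (η * freqSq L k ^ 2 + C) ≤ 1 := by
  have hpos : ∀ (C : ℝ), 0 ≤ C → ∀ k : Fin d → ℤ, 0 ≤ 1 / (η * freqSq L k ^ 2 + C) :=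
    fun C hC k => by positivity
  have hb : ∀ (C : ℝ), 1 ≤ C → ∀ k : Fin d → ℤ,
      1 / (η * freqSq L k ^ 2 + C) ≤ 1 / (η * freqSq L k ^ 2 + 1) := fun C hC k =>
    one_div_le_one_div_of_le (by positivity) (by linarith)
  have ht : Filter.Tendsto (fun C : ℝ => ∑' k : Fin d → ℤ, 1 / (η * freqSq L k ^ 2 + C))
      Filter.atTop (nhds (∑' _ : Fin d → ℤ, (0 : ℝ))) := by
    refine tendsto_tsum_of_dominated_convergence (summable_one_div_freqSq hd hL hη) ?_ ?_
    · intro k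
      exact (tendsto_const_nhds (x := (1 : ℝ))).div_atTop
        (Filter.tendsto_atTop_add_const_left _ _ Filter.tendsto_id)
    · filter_upwards [Filter.eventually_ge_atTop (1 : ℝ)] with C hC k
      rw [Real.norm_of_nonneg (hpos C (by linarith) k)]
      exact hb C hC k
  rw [tsum_zero] at ht
  obtain ⟨C, hC, hC1⟩ := ((ht.eventually (ge_mem_nhds one_pos)).and
    (Filter.eventually_ge_atTop (1 : ℝ))).exists
  refine ⟨C, by linarith, fun s => ?_⟩
  have hsum : Summable fun k : Fin d → ℤ => 1 / (η * freqSq L k ^ 2 + C) :=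
    (summable_one_div_freqSq hd hL hη).of_nonneg_of_le (hpos C (by linarith)) (hb C hC1)
  exact (hsum.sum_le_tsum s fun k _ => hpos C (by linarith) k).trans hC

namespace TrigPoly

variable {d : ℕ}

/-- An Agmon type inequality: the `ℓ¹` norm of the coefficients is controlled by an arbitrarily
small multiple of the `H²` seminorm and the `L²` norm. -/
lemma exists_wienerNorm_sq_le (hd : d ≤ 3) {L η : ℝ} (hL : 0 < L) (hη : 0 < η) :
    ∃ C : ℝ, 0 < C ∧ ∀ a : TrigPoly d, wienerNorm a ^ 2 ≤
      η * weightedSq (fun k => freqSq L k ^ 2) a + C * weightedSq (fun _ => 1) a := by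
  obtain ⟨C, hC, h⟩ := exists_sum_one_div_freqSq_le hd hL hη
  refine ⟨C, hC, fun a => ?_⟩
  have hw : ∀ k : Fin d → ℤ, 0 < η * freqSq L k ^ 2 + C := fun k => by positivity
  have h1 : wienerNorm a ^ 2 ≤ (∑ k ∈ a.coeff.support, 1 / (η * freqSq L k ^ 2 + C)) *
      ∑ k ∈ a.coeff.support, (η * freqSq L k ^ 2 + C) * ‖a.coeff k‖ ^ 2 :=
    Finset.sum_sq_le_sum_mul_sum_of_sq_le_mul _
      (fun k _ => (one_div_pos.2 (hw k)).le)
      (fun k _ => mul_nonneg (hw k).le (sq_nonneg _))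
      (fun k _ => le_of_eq (by have := (hw k).ne'; field_simp))
  refine h1.trans ((mul_le_of_le_one_left (Finset.sum_nonneg fun k _ =>
    mul_nonneg (hw k).le (sq_nonneg _)) (h _)).trans (le_of_eq ?_))
  rw [weightedSq, weightedSq, Finset.mul_sum, Finset.mul_sum, ← Finset.sum_add_distrib]
  exact Finset.sum_congr rfl fun k _ => by ring

/-- The coefficients of `(u³ - u) / ε²`. -/
def nonlinCoeff (ε : ℝ) (a : TrigPoly d) : TrigPoly d := ((ε ^ 2)⁻¹ : ℂ) • (a ^ 3 - a)

/-- In dimension at most three, `‖Δ f(v)‖² ≤ η ‖Δ² v‖² + C` for trigonometric polynomials `v`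
bounded in `H¹`. -/
lemma exists_weightedSq_nonlinCoeff_le (hd : d ≤ 3) {L : ℝ} (hL : 0 < L) (ε : ℝ) {η m : ℝ}
    (hη : 0 < η) (hm : 0 < m) :
    ∃ C : ℝ, 0 < C ∧ ∀ a : TrigPoly d, weightedSq (fun _ => 1) a ≤ m →
      weightedSq (freqSq L) a ≤ m →
      weightedSq (fun k => freqSq L k ^ 2) (nonlinCoeff ε a) ≤
        η * weightedSq (fun k => freqSq L k ^ 4) a + C := by
  set κ : ℝ := ‖((ε ^ 2)⁻¹ : ℂ)‖ ^ 2 with hκ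
  have hκ0 : 0 ≤ κ := sq_nonneg _
  -- The cubic term will carry the factor `816 κ s² m²`, which this choice keeps below `η`. The `+
  -- 1` guards against a zero denominator.
  set s : ℝ := Real.sqrt (η / (κ * 816 * m ^ 2 + 1)) with hs
  have hs0 : 0 < s := by positivity
  have hs2 : s ^ 2 * (κ * 816 * m ^ 2 + 1) = η := by
    rw [hs, Real.sq_sqrt (by positivity), div_mul_cancel₀ _ (by positivity)]
  obtain ⟨C, hC, hW⟩ := exists_wienerNorm_sq_le hd hL hs0
  set A : ℝ := 544 * (C * m) ^ 2 + 2 with hA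
  refine ⟨κ * (A * (1 + A / s ^ 2)) + 1, by positivity, fun a h0 h1 => ?_⟩
  have hq := freqSq_nonneg (d := d) L
  have hcube := weightedSq_cube_le hq (freqSq_add_le L) a
  have hint := weightedSq_interpolation hq a
  have hsub : weightedSq (fun k => freqSq L k ^ 2) (nonlinCoeff ε a) ≤
      κ * (2 * weightedSq (fun k => freqSq L k ^ 2) (a ^ 3) +
        2 * weightedSq (fun k => freqSq L k ^ 2) a) := by
    rw [nonlinCoeff, weightedSq_smul]
    refine mul_le_mul_of_nonneg_left ?_ hκ0
    have e1 := weightedSq_add_le (fun k => sq_nonneg (freqSq L k)) (a ^ 3) ((-1 : ℂ) • a)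
    rw [weightedSq_smul] at e1
    simpa [sub_eq_add_neg] using e1
  have hX := weightedSq_nonneg (fun k => sq_nonneg (freqSq L k)) a
  have hw := hW a
  have hp1 := weightedSq_nonneg hq a
  have hp0 := weightedSq_nonneg (fun _ => zero_le_one) a
  have hp4 := weightedSq_nonneg (fun k => pow_nonneg (hq k) 4) a
  have hwn := sq_nonneg (wienerNorm a)
  set X := weightedSq (fun k => freqSq L k ^ 2) a
  set Y := weightedSq (fun k => freqSq L k ^ 4) a
  set W := wienerNorm a ^ 2
  have e1 : W ≤ s * X + C * m := hw.trans (by gcongr)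
  have e2 : W ^ 2 ≤ 2 * s ^ 2 * X ^ 2 + 2 * (C * m) ^ 2 := by
    have := pow_le_pow_left₀ hwn e1 2
    nlinarith [sq_nonneg (s * X - C * m)]
  have e3 : 2 * (136 * W ^ 2 * X) + 2 * X ≤ 544 * s ^ 2 * X ^ 3 + A * X := by
    have := mul_le_mul_of_nonneg_right e2 hX
    rw [hA]
    nlinarith
  have hA0 : 0 < A := by positivity
  -- The linear term is either dominated by the cubic one or, when `X² ≤ A / s²`, bounded by a
  -- constant.
  have e4 : A * X ≤ s ^ 2 * X ^ 3 + A * (1 + A / s ^ 2) := by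
    rcases le_total A (s ^ 2 * X ^ 2) with h | h
    · have := mul_le_mul_of_nonneg_right h hX
      have : 0 ≤ A * (1 + A / s ^ 2) := by positivity
      nlinarith
    · have h' : X ^ 2 ≤ A / s ^ 2 := by
        rw [le_div_iff₀ (by positivity)]; linarith
      have : X ≤ 1 + A / s ^ 2 := by nlinarith [sq_nonneg (X - 1)]
      have := mul_le_mul_of_nonneg_left this hA0.le
      have : 0 ≤ s ^ 2 * X ^ 3 := by positivity
      linarith
  have e5 : X ^ 3 ≤ m ^ 2 * Y := hint.trans (by gcongr)
  calc _ ≤ κ * (2 * weightedSq (fun k => freqSq L k ^ 2) (a ^ 3) + 2 * X) := hsub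
    _ ≤ κ * (2 * (136 * W ^ 2 * X) + 2 * X) := by gcongr
    _ ≤ κ * (816 * s ^ 2 * (m ^ 2 * Y) + A * (1 + A / s ^ 2)) := by
        refine mul_le_mul_of_nonneg_left ?_ hκ0
        have : 0 ≤ s ^ 2 * X ^ 3 := by positivity
        have e6 := mul_le_mul_of_nonneg_left e5 (sq_nonneg s)
        linarith
    _ = (s ^ 2 * (κ * 816 * m ^ 2)) * Y + κ * (A * (1 + A / s ^ 2)) := by ring
    _ ≤ η * Y + (κ * (A * (1 + A / s ^ 2)) + 1) := by
        have : s ^ 2 * (κ * 816 * m ^ 2) ≤ η := by nlinarith [sq_nonneg s]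
        have := mul_le_mul_of_nonneg_right this hp4
        linarith

end TrigPoly
end CahnHilliard

namespace CahnHilliard

/-! ### Stability of the variable step BDF2 formula -/

section Mesh

lemma IsTimeMesh.step_pos {K : ℕ} {t : ℕ → ℝ} (ht : IsTimeMesh K t) {n : ℕ} (h1 : 1 ≤ n)
    (hn : n ≤ K) : 0 < step t n := sub_pos.2 (ht.lt n h1 hn)

lemma IsTimeMesh.sum_step {K : ℕ} {t : ℕ → ℝ} (ht : IsTimeMesh K t) (n : ℕ) :
    ∑ k ∈ Finset.Icc 1 n, step t k = t n := by
  induction n with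
  | zero => simp [ht.zero]
  | succ n ih =>
    rw [Finset.sum_Icc_succ_top (by omega), ih, step]
    simp

lemma ratio_of_two_le (t : ℕ → ℝ) {n : ℕ} (hn : 2 ≤ n) :
    ratio t n = step t n / step t (n - 1) := if_neg (by omega)

lemma StepRatioCond.nonneg {R δ : ℝ} {K : ℕ} {t : ℕ → ℝ} (h : StepRatioCond R δ K t) {n : ℕ}
    (hn : n ≤ K) : 0 ≤ ratio t n := by
  rcases le_or_gt n 1 with h1 | h1
  · exact (if_pos h1).ge
  · exact (h n h1 hn).1.le

lemma StepRatioCond.le {R δ : ℝ} {K : ℕ} {t : ℕ → ℝ} (h : StepRatioCond R δ K t) (hδ : δ ≤ R)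
    {n : ℕ} (hn : n ≤ K) : ratio t n ≤ R - δ := by
  rcases le_or_gt n 1 with h1 | h1
  · exact (if_pos h1).le.trans (sub_nonneg.2 hδ)
  · exact (h n h1 hn).2

lemma bdf2_eq {V : Type*} [AddCommGroup V] [Module ℝ V] (t : ℕ → ℝ) (u : ℕ → V) {n : ℕ}
    (hn : 1 ≤ n) :
    bdf2 t u n = ((1 + 2 * ratio t n) / (step t n * (1 + ratio t n))) • (u n - u (n - 1)) -
      (ratio t n ^ 2 / (step t n * (1 + ratio t n))) • (u (n - 1) - u (n - 1 - 1)) := by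
  obtain ⟨m, rfl⟩ : ∃ m, n = m + 1 := ⟨n - 1, by omega⟩
  cases m with
  | zero => simp [bdf2, bdfKernel]
  | succ m =>
    rw [bdf2, Finset.sum_Icc_succ_top (by omega), Finset.sum_Icc_succ_top (by omega),
      Finset.sum_eq_zero]
    · have h1 : m + 1 + 1 - (m + 1) = 1 := by omega
      have h2 : m + 1 + 1 - (m + 1 + 1) = 0 := by omega
      rw [h1, h2]
      simp only [bdfKernel, neg_div, neg_smul, Nat.add_sub_cancel]
      abel
    · intro k hk
      obtain ⟨j, hj⟩ : ∃ j, m + 1 + 1 - k = j + 2 := ⟨m - k, by grind⟩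
      rw [hj]
      simp [bdfKernel]

end Mesh

/-! ### The step-ratio threshold -/

section RootOfCubic

variable {R : ℝ}

/-- For positive `R` the equation reads `R² (R - 4) = 4R + 1 > 0`; nonpositive `R` would force `2R +
1 = 0`, which is not a root. -/
lemma four_lt_of_cube_eq (hR : R ^ 3 = (2 * R + 1) ^ 2) : 4 < R := by
  have h0 : 0 < R := by
    by_contra h
    push Not at h
    have h3 : R ^ 3 ≤ 0 := by nlinarith [sq_nonneg R]
    have h1 : (2 * R + 1) ^ 2 = 0 := le_antisymm (hR ▸ h3) (sq_nonneg _)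
    have h2 : R = -1 / 2 := by linarith [pow_eq_zero_iff (two_ne_zero) |>.1 h1]
    rw [h2] at hR
    norm_num at hR
  have : 0 < R ^ 2 * (R - 4) := by nlinarith
  linarith [pos_of_mul_pos_right this (sq_nonneg R)]

lemma lt_five_of_cube_eq (hR : R ^ 3 = (2 * R + 1) ^ 2) : R < 5 := by
  by_contra h
  push Not at h
  nlinarith [mul_nonneg (sub_nonneg.2 h) (sq_nonneg R), mul_nonneg (sub_nonneg.2 h)
    (by linarith : 0 ≤ R)]

/-- The scalar inequality behind the positivity of the BDF2 kernels. -/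
lemma bdf2_scalar_le (hR : R ^ 3 = (2 * R + 1) ^ 2) {r δ : ℝ} (hr : 0 ≤ r) (hrδ : r ≤ R - δ)
    (hδ : 0 < δ) :
    (2 * R + 1) / (R + 1) + δ / (R * (R + 1) ^ 3) +
      r ^ 3 / ((1 + r) ^ 2 * ((2 * R + 1) / (R + 1))) ≤ (2 + 4 * r) / (1 + r) := by
  have hR4 := four_lt_of_cube_eq hR
  have hr1 : 0 < 1 + r := by linarith
  have hR1 : 0 < R + 1 := by linarith
  have hR2 : 0 < 2 * R + 1 := by linarith
  have hR0 : 0 < R := by linarith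
  set N := (2 + 4 * r) * (1 + r) * (2 * R + 1) * (R + 1) - (2 * R + 1) ^ 2 * (1 + r) ^ 2 -
    r ^ 3 * (R + 1) ^ 2 with hN
  -- At `r = R` the cubic says `R³ / (1 + R)² = μ²`, so with `μ = (2R + 1)/(R + 1)` the inequality
  -- without its `δ` term is the equality `μ + μ = 2μ`. Hence `N` vanishes there, and the factor `R
  -- - r ≥ δ` supplies the margin.
  have hfac : R ^ 2 * N = R * (R - r) * (2 * R + 1) + (R - r) * r *
      (R ^ 2 * (R + 1) ^ 2 * r + R * (2 * R + 1) * (2 * R + 4) + (2 * R + 1)) := by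
    rw [hN]
    linear_combination (-(r ^ 2 * (R + 1) ^ 2)) * hR
  have hN' : δ * (2 * R + 1) ≤ R * N := by
    have h1 : 0 ≤ (R - r) * r *
        (R ^ 2 * (R + 1) ^ 2 * r + R * (2 * R + 1) * (2 * R + 4) + (2 * R + 1)) := by
      have : 0 ≤ R - r := by linarith
      positivity
    have h2 : R * (δ * (2 * R + 1)) ≤ R * ((R - r) * (2 * R + 1)) := by
      gcongr
      linarith
    refine le_of_mul_le_mul_left ?_ hR0
    nlinarith
  have key : (2 + 4 * r) / (1 + r) - (2 * R + 1) / (R + 1) -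
      r ^ 3 / ((1 + r) ^ 2 * ((2 * R + 1) / (R + 1))) =
      N / ((1 + r) ^ 2 * (R + 1) * (2 * R + 1)) := by
    rw [hN]
    field_simp
  have h3 : δ / (R * (R + 1) ^ 3) ≤ N / ((1 + r) ^ 2 * (R + 1) * (2 * R + 1)) := by
    rw [div_le_div_iff₀ (by positivity) (by positivity)]
    calc δ * ((1 + r) ^ 2 * (R + 1) * (2 * R + 1))
        = (δ * (2 * R + 1)) * ((1 + r) ^ 2 * (R + 1)) := by ring
      _ ≤ (δ * (2 * R + 1)) * ((R + 1) ^ 2 * (R + 1)) := by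
          gcongr ?_ * (?_ ^ 2 * ?_)
          linarith
      _ ≤ (R * N) * ((R + 1) ^ 2 * (R + 1)) := by gcongr
      _ = N * (R * (R + 1) ^ 3) := by ring
  linarith

end RootOfCubic

/-! ### Coercivity of BDF2 and the abstract energy estimate -/

section Energy

variable {V : Type*} [AddCommGroup V] [Module ℝ V] {B : LinearMap.BilinForm ℝ V}

lemma bilin_sub_smul_self (hs : ∀ x y, B x y = B y x) (α β : ℝ) (x y : V) :
    B (α • x - β • y) (α • x - β • y) = α ^ 2 * B x x - 2 * α * β * B x y + β ^ 2 * B y y := by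
  simp only [map_sub, map_smul, LinearMap.sub_apply, LinearMap.smul_apply, smul_eq_mul, hs y x]
  ring

lemma two_mul_bilin_le (hs : ∀ x y, B x y = B y x) (hp : ∀ x, 0 ≤ B x x) {s : ℝ} (hs0 : 0 < s)
    (x y : V) : 2 * B x y ≤ s * B x x + s⁻¹ * B y y := by
  have h := hp (s • x - (1 : ℝ) • y)
  rw [bilin_sub_smul_self hs] at h
  have h2 : s⁻¹ * (s ^ 2 * B x x - 2 * s * 1 * B x y + 1 ^ 2 * B y y) =
      s * B x x + s⁻¹ * B y y - 2 * B x y := by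
    field_simp
    ring
  have := mul_nonneg (inv_pos.2 hs0).le h
  linarith

lemma bilin_sub_smul_self_le (hs : ∀ x y, B x y = B y x) (hp : ∀ x, 0 ≤ B x x) (α β : ℝ)
    (x y : V) :
    B (α • x - β • y) (α • x - β • y) ≤ 2 * α ^ 2 * B x x + 2 * β ^ 2 * B y y := by
  have h := hp (α • x - (-β) • y)
  rw [bilin_sub_smul_self hs] at h ⊢
  linarith

/-- The cross term is split by expanding the square of `(r / (1 + r)) • g - μ • h`, scaled by `r /
(τ * μ)`. This leaves exactly `μ r ‖h‖² / τ` on the older difference, the quantity that telescopes,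
and `bdf2_scalar_le` handles the coefficient of `‖g‖²`. -/
lemma bdf2_lower_bound {R : ℝ} (hR : R ^ 3 = (2 * R + 1) ^ 2) (hs : ∀ x y, B x y = B y x)
    (hp : ∀ x, 0 ≤ B x x) {r δ τ : ℝ} (hτ : 0 < τ) (hr : 0 ≤ r) (hrδ : r ≤ R - δ) (hδ : 0 < δ)
    (g h : V) :
    ((2 * R + 1) / (R + 1) + δ / (R * (R + 1) ^ 3)) * (B g g / τ) -
        (2 * R + 1) / (R + 1) * (r * B h h / τ) ≤
      2 * B (((1 + 2 * r) / (τ * (1 + r))) • g - (r ^ 2 / (τ * (1 + r))) • h) g := by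
  have hR4 := four_lt_of_cube_eq hR
  have hscal := bdf2_scalar_le hR hr hrδ hδ
  have hμ : 0 < (2 * R + 1) / (R + 1) := by
    have : 0 < R + 1 := by linarith
    have : 0 < 2 * R + 1 := by linarith
    positivity
  set μ := (2 * R + 1) / (R + 1)
  have hr1 : 0 < 1 + r := by linarith
  have hsq := hp ((r / (1 + r)) • g - μ • h)
  rw [bilin_sub_smul_self hs] at hsq
  have h1 := mul_nonneg (by positivity : 0 ≤ r / (τ * μ)) hsq
  have h2 := mul_le_mul_of_nonneg_right hscal (div_nonneg (hp g) hτ.le)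
  have e1 : r / (τ * μ) * ((r / (1 + r)) ^ 2 * B g g - 2 * (r / (1 + r)) * μ * B g h +
      μ ^ 2 * B h h) = r ^ 3 / ((1 + r) ^ 2 * μ) * (B g g / τ) -
      2 * (r ^ 2 / (τ * (1 + r))) * B g h + μ * (r * B h h / τ) := by
    field_simp
  have e2 : 2 * B (((1 + 2 * r) / (τ * (1 + r))) • g - (r ^ 2 / (τ * (1 + r))) • h) g =
      (2 + 4 * r) / (1 + r) * (B g g / τ) - 2 * (r ^ 2 / (τ * (1 + r))) * B g h := by
    simp only [map_sub, map_smul, LinearMap.sub_apply, LinearMap.smul_apply, smul_eq_mul, hs h g]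
    field_simp
    ring
  rw [e2]
  rw [e1] at h1
  linarith

lemma bdf2_upper_bound (hs : ∀ x y, B x y = B y x)
    (hp : ∀ x, 0 ≤ B x x) {r τ : ℝ} (hτ : 0 < τ) (hr : 0 ≤ r) (hr5 : r ≤ 5) (g h : V) :
    τ * B (((1 + 2 * r) / (τ * (1 + r))) • g - (r ^ 2 / (τ * (1 + r))) • h)
        (((1 + 2 * r) / (τ * (1 + r))) • g - (r ^ 2 / (τ * (1 + r))) • h) ≤
      8 * (B g g / τ) + 10 * (r * B h h / τ) := by
  have hr1 : 0 < 1 + r := by linarith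
  refine (mul_le_mul_of_nonneg_left (bilin_sub_smul_self_le hs hp _ _ g h) hτ.le).trans ?_
  have e : τ * (2 * ((1 + 2 * r) / (τ * (1 + r))) ^ 2 * B g g +
      2 * (r ^ 2 / (τ * (1 + r))) ^ 2 * B h h) =
      2 * ((1 + 2 * r) / (1 + r)) ^ 2 * (B g g / τ) +
      2 * (r * (r / (1 + r)) ^ 2) * (r * B h h / τ) := by
    field_simp
  rw [e]
  have h1 : ((1 + 2 * r) / (1 + r)) ^ 2 ≤ 2 ^ 2 := by
    gcongr
    rw [div_le_iff₀ hr1]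
    linarith
  have h2 : (r / (1 + r)) ^ 2 ≤ 1 := by
    refine pow_le_one₀ (by positivity) ?_
    rw [div_le_one hr1]
    linarith
  have h3 : r * (r / (1 + r)) ^ 2 ≤ 5 := by nlinarith
  have hg : 0 ≤ B g g / τ := div_nonneg (hp g) hτ.le
  have hh : 0 ≤ r * B h h / τ := div_nonneg (mul_nonneg hr (hp h)) hτ.le
  have := mul_le_mul_of_nonneg_right h1 hg
  have := mul_le_mul_of_nonneg_right h3 hh
  linarith

/-- Energy stability of the BDF2 formula for an abstract gradient flow `u' + S = F`, where
`S = Δ² u` and `w = Δ u`. -/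
theorem bdf2_energy_stability {R : ℝ} (hR : R ^ 3 = (2 * R + 1) ^ 2)
    (hs : ∀ x y, B x y = B y x) (hp : ∀ x, 0 ≤ B x x) {δ : ℝ} (hδ : 0 < δ) (hδR : δ < R)
    {K : ℕ} {t : ℕ → ℝ} (ht : IsTimeMesh K t) (hA : StepRatioCond R δ K t) {u S F w : ℕ → V}
    (h1 : ∀ n, 1 ≤ n → n ≤ K → B (bdf2 t u n + S n - F n) (u n - u (n - 1)) = 0)
    (h2 : ∀ n, 1 ≤ n → n ≤ K → B (bdf2 t u n + S n - F n) (S n) = 0)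
    (h3 : ∀ n, 1 ≤ n → n ≤ K → B (w n) (w n) - B (w (n - 1)) (w (n - 1)) ≤
      2 * B (S n) (u n - u (n - 1))) {n : ℕ} (hn : n ≤ K) :
    B (w n) (w n) + δ / (72 * (R * (R + 1) ^ 3)) *
        ∑ k ∈ Finset.Icc 1 n, step t k * B (S k) (S k) ≤
      B (w 0) (w 0) + 4 * (R * (R + 1) ^ 3) / δ *
        ∑ k ∈ Finset.Icc 1 n, step t k * B (F k) (F k) := by
  have hR4 := four_lt_of_cube_eq hR
  have hR5 := lt_five_of_cube_eq hR
  have hR0 : 0 < R := by linarith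
  set q := R * (R + 1) ^ 3 with hq
  have hq0 : 0 < q := by positivity
  set μ := (2 * R + 1) / (R + 1) with hμ
  have hμ0 : 0 < μ := by positivity
  let g : ℕ → V := fun n => u n - u (n - 1)
  let D : ℕ → ℝ := fun n => B (g n) (g n) / step t n
  have hD : ∀ n, n ≤ K → 0 ≤ D n := fun n hn => by
    rcases Nat.eq_zero_or_pos n with h | h
    · simp [D, g, h]
    · exact div_nonneg (hp _) (ht.step_pos h hn).le
  -- Since `r_{n+1} / τ_{n+1} = 1 / τ_n`, the older difference reappears as `D n`. For `n = 0` both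
  -- sides vanish because `0 - 1 = 0` makes `g 0 = 0`.
  have hprev : ∀ n, n + 1 ≤ K →
      ratio t (n + 1) * B (g n) (g n) / step t (n + 1) = D n := fun n hn => by
    rcases Nat.eq_zero_or_pos n with h | h
    · simp [D, g, h]
    · have e1 := (ht.step_pos h (by omega)).ne'
      have e2 := (ht.step_pos (by omega : 1 ≤ n + 1) hn).ne'
      rw [ratio_of_two_le t (by omega), Nat.add_sub_cancel]
      simp only [D]
      field_simp
  have hFF : ∀ n, n ≤ K → 0 ≤ ∑ k ∈ Finset.Icc 1 n, step t k * B (F k) (F k) := fun n hn =>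
    Finset.sum_nonneg fun k hk => mul_nonneg
      (ht.step_pos (Finset.mem_Icc.1 hk).1 ((Finset.mem_Icc.1 hk).2.trans hn)).le (hp _)
  have henergy : ∀ n, n ≤ K → B (w n) (w n) + μ * D n +
      δ / (2 * q) * ∑ k ∈ Finset.Icc 1 n, D k ≤ B (w 0) (w 0) +
      2 * q / δ * ∑ k ∈ Finset.Icc 1 n, step t k * B (F k) (F k) := by
    intro n
    induction n with
    | zero => intro _; simp [D, g]
    | succ n ih =>
      intro hn
      have ih := ih (by omega)
      have hτ := ht.step_pos (by omega : 1 ≤ n + 1) hn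
      have hr := hA.nonneg hn
      have hlow := bdf2_lower_bound hR hs hp hτ hr (hA.le hδR.le hn) hδ (g (n + 1)) (g n)
      rw [hprev n hn] at hlow
      have e1 := h1 (n + 1) (by omega) hn
      have e3 := h3 (n + 1) (by omega) hn
      have hb := bdf2_eq t u (by omega : 1 ≤ n + 1)
      change bdf2 t u (n + 1) = _ • g (n + 1) - _ • g n at hb
      rw [← hb] at hlow
      rw [LinearMap.BilinForm.sub_left, LinearMap.BilinForm.add_left] at e1
      rw [Nat.add_sub_cancel] at e1 e3
      -- The Young weight spends half of the surplus `δ / q * D (n + 1)` on the forcing; the other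
      -- half stays as dissipation.
      have hY := two_mul_bilin_le hs hp (s := 2 * q / δ * step t (n + 1)) (by positivity)
        (F (n + 1)) (g (n + 1))
      have hY2 : (2 * q / δ * step t (n + 1))⁻¹ * B (g (n + 1)) (g (n + 1)) =
          δ / (2 * q) * D (n + 1) := by
        simp only [D]
        field_simp
      have hx : δ / q * D (n + 1) = 2 * (δ / (2 * q) * D (n + 1)) := by
        field_simp
      rw [hY2] at hY
      change (μ + δ / q) * D (n + 1) - μ * D n ≤ 2 * B _ (u (n + 1) - u n) at hlow
      change 2 * B _ (u (n + 1) - u n) ≤ _ at hY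
      rw [Finset.sum_Icc_succ_top (by omega), Finset.sum_Icc_succ_top (by omega), mul_add,
        mul_add]
      linarith
  -- Doubling the upper bound for `τ ‖D₂u‖²` costs `16 D (n + 1) + 20 D n`. The carried term `20 * D
  -- n` pays for the older part, and renewing it gives `36 = 16 + 20`.
  have hS : ∀ n, n ≤ K → ∑ k ∈ Finset.Icc 1 n, step t k * B (S k) (S k) + 20 * D n ≤
      36 * ∑ k ∈ Finset.Icc 1 n, D k +
      2 * ∑ k ∈ Finset.Icc 1 n, step t k * B (F k) (F k) := by
    intro n
    induction n with
    | zero => intro _; simp [D, g]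
    | succ n ih =>
      intro hn
      have ih := ih (by omega)
      have hτ := ht.step_pos (by omega : 1 ≤ n + 1) hn
      have hr := hA.nonneg hn
      have hr5 : ratio t (n + 1) ≤ 5 := by linarith [hA.le hδR.le hn]
      have hup := bdf2_upper_bound hs hp hτ hr hr5 (g (n + 1)) (g n)
      rw [hprev n hn] at hup
      have e2 := h2 (n + 1) (by omega) hn
      have hb := bdf2_eq t u (by omega : 1 ≤ n + 1)
      change bdf2 t u (n + 1) = _ • g (n + 1) - _ • g n at hb
      rw [← hb] at hup
      have hY := two_mul_bilin_le hs hp one_pos ((1 : ℝ) • F (n + 1) - (1 : ℝ) • bdf2 t u (n + 1))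
        (S (n + 1))
      have hY2 := bilin_sub_smul_self_le hs hp 1 1 (F (n + 1)) (bdf2 t u (n + 1))
      rw [one_smul, one_smul] at hY hY2
      rw [LinearMap.BilinForm.sub_left, LinearMap.BilinForm.add_left] at e2
      rw [LinearMap.BilinForm.sub_left (F (n + 1)) _ (S (n + 1))] at hY
      have hY3 : B (S (n + 1)) (S (n + 1)) ≤ 2 * B (F (n + 1)) (F (n + 1)) +
          2 * B (bdf2 t u (n + 1)) (bdf2 t u (n + 1)) := by linarith
      have hY4 := mul_le_mul_of_nonneg_left hY3 hτ.le
      rw [Finset.sum_Icc_succ_top (by omega), Finset.sum_Icc_succ_top (by omega),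
        Finset.sum_Icc_succ_top (by omega)]
      change _ ≤ 8 * D (n + 1) + _ at hup
      linarith
  have hH := henergy n hn
  have hT := hS n hn
  have hF0 := hFF n hn
  have hD0 := hD n hn
  set sD := ∑ k ∈ Finset.Icc 1 n, D k
  set sF := ∑ k ∈ Finset.Icc 1 n, step t k * B (F k) (F k)
  set sS := ∑ k ∈ Finset.Icc 1 n, step t k * B (S k) (S k)
  -- The factor `δ / (72 q)` makes `36 ∑ D` use up exactly the dissipation `δ / (2q) ∑ D`.
  have hc : δ / (72 * q) * sS ≤ δ / (72 * q) * (36 * sD + 2 * sF) := by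
    refine mul_le_mul_of_nonneg_left ?_ (by positivity)
    linarith
  have hc2 : δ / (72 * q) * (36 * sD + 2 * sF) = δ / (2 * q) * sD + δ / (36 * q) * sF := by
    field_simp
    ring
  have hqR : δ ≤ q := by
    have : 1 ≤ (R + 1) ^ 3 := one_le_pow₀ (by linarith)
    have : R * 1 ≤ R * (R + 1) ^ 3 := by gcongr
    linarith
  have hc3 : δ / (36 * q) ≤ 2 * q / δ := by
    rw [div_le_div_iff₀ (by positivity) hδ]
    nlinarith
  have hc4 := mul_le_mul_of_nonneg_right hc3 hF0
  have hμD := mul_nonneg hμ0.le hD0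
  have e : 4 * q / δ * sF = 2 * q / δ * sF + 2 * q / δ * sF := by ring
  rw [e]
  linarith

end Energy
end CahnHilliard

namespace CahnHilliard

/-! ### Evaluation of trigonometric polynomials -/

/-- The phase `x ↦ ∑_j (2π k_j / L) x_j` of a Fourier mode. -/
def phase {d : ℕ} (L : ℝ) (k : Fin d → ℤ) : Space d →L[ℝ] ℝ :=
  ∑ j, (2 * Real.pi * (k j : ℝ) / L) • EuclideanSpace.proj j

lemma fourierMode_eq {d : ℕ} (L : ℝ) (k : Fin d → ℤ) (x : Space d) :
    fourierMode d L k x = Complex.exp (Complex.I * (phase L k x : ℝ)) := by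
  simp [fourierMode, phase]

lemma phase_add {d : ℕ} (L : ℝ) (k l : Fin d → ℤ) (x : Space d) :
    phase L (k + l) x = phase L k x + phase L l x := by
  simp only [phase, sum_apply, smul_apply,
    smul_eq_mul, ← Finset.sum_add_distrib]
  refine Finset.sum_congr rfl fun j _ => ?_
  rw [Pi.add_apply, Int.cast_add]
  ring

lemma phase_zero {d : ℕ} (L : ℝ) (x : Space d) : phase L (0 : Fin d → ℤ) x = 0 := by
  simp [phase]

lemma phase_single {d : ℕ} (L : ℝ) (k : Fin d → ℤ) (j : Fin d) :
    phase L k (EuclideanSpace.single j 1) = 2 * Real.pi * (k j : ℝ) / L := by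
  simp [phase]

namespace TrigPoly

variable {d : ℕ}

/-- The function on `ℝ^d` given by a formal trigonometric polynomial. -/
def eval (L : ℝ) : TrigPoly d →ₐ[ℂ] (Space d → ℂ) :=
  AddMonoidAlgebra.lift ℂ (Space d → ℂ) (Fin d → ℤ)
    { toFun := fun k => fourierMode d L k.toAdd
      map_one' := by
        funext x
        simp [fourierMode_eq, phase_zero]
      map_mul' := fun k l => by
        funext x
        simp [fourierMode_eq, phase_add, mul_add, Complex.exp_add] }

lemma eval_eq_sum (L : ℝ) (a : TrigPoly d) :
    eval L a = ∑ k ∈ a.coeff.support, a.coeff k • fourierMode d L k := by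
  rw [eval, AddMonoidAlgebra.lift_apply]
  rfl

lemma eval_apply (L : ℝ) (a : TrigPoly d) (x : Space d) :
    eval L a x = ∑ k ∈ a.coeff.support, a.coeff k * fourierMode d L k x := by
  rw [eval_eq_sum]
  simp

lemma eval_apply_of_subset (L : ℝ) (a : TrigPoly d) (x : Space d) {s : Finset (Fin d → ℤ)}
    (hs : a.coeff.support ⊆ s) :
    eval L a x = ∑ k ∈ s, a.coeff k * fourierMode d L k x := by
  rw [eval_apply]
  refine Finset.sum_subset hs fun k _ hk => ?_
  simp [Finsupp.notMem_support_iff.1 hk]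

/-- The Fourier multiplier with symbol `m`. -/
def multiplier (m : (Fin d → ℤ) → ℂ) : TrigPoly d →ₗ[ℂ] TrigPoly d where
  toFun a := AddMonoidAlgebra.ofCoeff
    (Finsupp.onFinset a.coeff.support (fun k => m k * a.coeff k)
      (fun k hk => Finsupp.mem_support_iff.2 (right_ne_zero_of_mul hk)))
  map_add' a b := by
    ext k
    simp [mul_add]
  map_smul' c a := by
    ext k
    simp [mul_left_comm]

@[simp]
lemma coeff_multiplier (m : (Fin d → ℤ) → ℂ) (a : TrigPoly d) (k : Fin d → ℤ) :
    (multiplier m a).coeff k = m k * a.coeff k := rfl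

lemma support_multiplier (m : (Fin d → ℤ) → ℂ) (a : TrigPoly d) :
    (multiplier m a).coeff.support ⊆ a.coeff.support := fun k hk =>
  Finsupp.mem_support_iff.2
    (right_ne_zero_of_mul (a := m k) (by simpa using Finsupp.mem_support_iff.1 hk))

lemma weightedSq_multiplier (w : (Fin d → ℤ) → ℝ) (m : (Fin d → ℤ) → ℂ) (a : TrigPoly d) :
    weightedSq w (multiplier m a) = weightedSq (fun k => w k * ‖m k‖ ^ 2) a := by
  rw [weightedSq_eq_sum w _ (support_multiplier m a), weightedSq]
  refine Finset.sum_congr rfl fun k _ => ?_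
  rw [coeff_multiplier, norm_mul]
  ring

/-- The partial derivative `∂_j` on coefficients. -/
def partialDeriv (L : ℝ) (j : Fin d) : TrigPoly d →ₗ[ℂ] TrigPoly d :=
  multiplier fun k => Complex.I * ((2 * Real.pi * (k j : ℝ) / L : ℝ) : ℂ)

/-- The Laplacian on coefficients. -/
def laplace (L : ℝ) : TrigPoly d →ₗ[ℂ] TrigPoly d :=
  multiplier fun k => ((-freqSq L k : ℝ) : ℂ)

lemma sum_partialDeriv_sq (L : ℝ) (a : TrigPoly d) :
    ∑ j, partialDeriv L j (partialDeriv L j a) = laplace L a := by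
  ext k
  simp only [partialDeriv, laplace, AddMonoidAlgebra.coeff_sum, Finsupp.finsetSum_apply,
    coeff_multiplier, freqSq, ← mul_assoc, ← Finset.sum_mul]
  congr 1
  rw [← Finset.sum_neg_distrib, Complex.ofReal_sum]
  refine Finset.sum_congr rfl fun j _ => ?_
  rw [mul_right_comm Complex.I, Complex.I_mul_I]
  push_cast
  ring

lemma sum_weightedSq_partialDeriv (L : ℝ) (a : TrigPoly d) :
    ∑ j, weightedSq (fun _ => 1) (partialDeriv L j a) = weightedSq (freqSq L) a := by
  simp only [partialDeriv, weightedSq_multiplier]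
  unfold weightedSq
  rw [Finset.sum_comm]
  refine Finset.sum_congr rfl fun k _ => ?_
  rw [← Finset.sum_mul, freqSq]
  congr 1
  refine Finset.sum_congr rfl fun j _ => ?_
  change 1 * ‖_‖ ^ 2 = _
  rw [norm_mul, Complex.norm_I, Complex.norm_real, one_mul, one_mul, Real.norm_eq_abs, sq_abs]

lemma weightedSq_laplace (L : ℝ) (w : (Fin d → ℤ) → ℝ) (a : TrigPoly d) :
    weightedSq w (laplace L a) = weightedSq (fun k => w k * freqSq L k ^ 2) a := by
  rw [laplace, weightedSq_multiplier]
  congr 1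
  funext k
  rw [Complex.norm_real, norm_neg, Real.norm_eq_abs, sq_abs]

lemma hasFDerivAt_fourierMode (L : ℝ) (k : Fin d → ℤ) (x : Space d) :
    HasFDerivAt (fourierMode d L k)
      (fourierMode d L k x • (Complex.I • (Complex.ofRealCLM.comp (phase L k)))) x := by
  have h1 : HasFDerivAt (fun y : Space d => Complex.I * ((phase L k y : ℝ) : ℂ))
      (Complex.I • (Complex.ofRealCLM.comp (phase L k))) x :=
    ((Complex.ofRealCLM.comp (phase L k)).hasFDerivAt).const_mul Complex.I
  have h2 := h1.cexp
  rw [← fourierMode_eq] at h2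
  exact h2.congr_of_eventuallyEq (Filter.Eventually.of_forall fun y => fourierMode_eq L k y)

lemma contDiff_fourierMode (L : ℝ) (k : Fin d → ℤ) {n : WithTop ℕ∞} :
    ContDiff ℝ n (fourierMode d L k) := by
  have : fourierMode d L k = fun x => Complex.exp (Complex.I * (phase L k x : ℝ)) :=
    funext fun x => fourierMode_eq L k x
  rw [this]
  exact (contDiff_const.mul ((Complex.ofRealCLM.comp (phase L k)).contDiff)).cexp

lemma contDiff_eval (L : ℝ) (a : TrigPoly d) {n : WithTop ℕ∞} : ContDiff ℝ n (eval L a) := by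
  have : eval L a = fun x => ∑ k ∈ a.coeff.support, a.coeff k * fourierMode d L k x :=
    funext fun x => eval_apply L a x
  rw [this]
  exact ContDiff.sum fun k _ => contDiff_const.mul (contDiff_fourierMode L k)

lemma fderiv_eval_single (L : ℝ) (a : TrigPoly d) (x : Space d) (j : Fin d) :
    fderiv ℝ (eval L a) x (EuclideanSpace.single j 1) = eval L (partialDeriv L j a) x := by
  have h : HasFDerivAt (eval L a) (∑ k ∈ a.coeff.support, a.coeff k •
      (fourierMode d L k x • (Complex.I • (Complex.ofRealCLM.comp (phase L k))))) x := by
    have : eval L a = fun x => ∑ k ∈ a.coeff.support, a.coeff k * fourierMode d L k x :=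
      funext fun x => eval_apply L a x
    rw [this]
    exact HasFDerivAt.fun_sum fun k _ => (hasFDerivAt_fourierMode L k x).const_mul _
  rw [h.fderiv, partialDeriv, eval_apply_of_subset L _ x (support_multiplier _ a)]
  simp only [sum_apply]
  refine Finset.sum_congr rfl fun k _ => ?_
  simp only [smul_apply, ContinuousLinearMap.comp_apply, phase_single,
    Complex.ofRealCLM_apply, smul_eq_mul, coeff_multiplier]
  ring

lemma laplacian_eval (L : ℝ) (a : TrigPoly d) (x : Space d) :
    Laplacian.laplacian (eval L a) x = eval L (laplace L a) x := by
  rw [InnerProductSpace.laplacian_eq_iteratedFDeriv_orthonormalBasis _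
    (EuclideanSpace.basisFun (Fin d) ℝ), ← sum_partialDeriv_sq, map_sum, Finset.sum_apply]
  refine Finset.sum_congr rfl fun j _ => ?_
  rw [iteratedFDeriv_two_apply, ← fderiv_eval_single]
  have hd : DifferentiableAt ℝ (fderiv ℝ (eval L a)) x :=
    ((contDiff_eval L a (n := 2)).fderiv_right (m := 1) (by norm_num)).differentiable
      (by norm_num) x
  have he : eval L (partialDeriv L j a) =
      fun y => fderiv ℝ (eval L a) y (EuclideanSpace.single j 1) :=
    funext fun y => (fderiv_eval_single L a y j).symm
  rw [he, fderiv_clm_apply hd (differentiableAt_const _)]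
  simp

/-- The real function `u` is given by the trigonometric polynomial `a`. -/
def Represents (L : ℝ) (a : TrigPoly d) (u : Space d → ℝ) : Prop :=
  ∀ x, eval L a x = (u x : ℂ)

namespace Represents

variable {L : ℝ} {a b : TrigPoly d} {u v : Space d → ℝ}

lemma eq_comp (h : Represents L a u) : Complex.ofRealCLM ∘ u = eval L a :=
  funext fun x => (h x).symm

lemma contDiff (h : Represents L a u) {n : WithTop ℕ∞} : ContDiff ℝ n u := by
  have : u = Complex.reCLM ∘ eval L a := funext fun x => by simp [h x]
  rw [this]
  exact Complex.reCLM.contDiff.comp (contDiff_eval L a)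

lemma sub (ha : Represents L a u) (hb : Represents L b v) : Represents L (a - b) (u - v) :=
  fun x => by simp [ha x, hb x]

lemma smul (c : ℝ) (ha : Represents L a u) : Represents L (c • a) (c • u) := fun x => by
  have : c • a = (c : ℂ) • a := by
    ext k
    simp
  rw [this, map_smul, Pi.smul_apply, ha x]
  simp

lemma nonlin (ε : ℝ) (ha : Represents L a u) :
    Represents L (nonlinCoeff ε a) (nonlin ε u) := fun x => by
  simp only [nonlinCoeff, CahnHilliard.nonlin, map_smul, map_sub, map_pow, Pi.smul_apply,
    Pi.sub_apply, Pi.pow_apply, ha x, smul_eq_mul]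
  push_cast
  ring

lemma lap (ha : Represents L a u) : Represents L (laplace L a) (lap u) := fun x => by
  rw [← laplacian_eval, ← ha.eq_comp,
    (ha.contDiff (n := 2)).contDiffAt.laplacian_CLM_comp_left]
  rfl

lemma grad (ha : Represents L a u) (j : Fin d) :
    Represents L (partialDeriv L j a) (fun x => grad u x j) := fun x => by
  have hu : DifferentiableAt ℝ u x := (ha.contDiff (n := 1)).differentiable (by norm_num) x
  rw [← fderiv_eval_single, ← ha.eq_comp,
    fderiv_comp x Complex.ofRealCLM.differentiableAt hu]
  have h : inner ℝ (gradient u x) (EuclideanSpace.single j (1 : ℝ)) =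
      fderiv ℝ u x (EuclideanSpace.single j 1) := by
    rw [gradient, InnerProductSpace.toDual_symm_apply]
  rw [EuclideanSpace.inner_single_right] at h
  simp only [one_mul, conj_trivial] at h
  simp [CahnHilliard.grad, h]

end Represents

end TrigPoly
end CahnHilliard

namespace CahnHilliard

/-! ### Integration over the box -/

section Box

variable {d : ℕ} {L : ℝ}

lemma toLp_preimage_box : WithLp.toLp 2 ⁻¹' box d L =
    Set.univ.pi (fun _ : Fin d => Set.Ioo 0 L) := by
  ext y
  simp [box]

lemma setIntegral_box {E : Type*} [NormedAddCommGroup E] [NormedSpace ℝ E] (f : Space d → E) :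
    ∫ x in box d L, f x =
      ∫ y in Set.univ.pi (fun _ : Fin d => Set.Ioo 0 L), f (WithLp.toLp 2 y) := by
  rw [← toLp_preimage_box]
  exact ((PiLp.volume_preserving_toLp (Fin d)).setIntegral_preimage_emb
    (MeasurableEquiv.toLp 2 (Fin d → ℝ)).measurableEmbedding f (box d L)).symm

lemma integrableOn_box {E : Type*} [NormedAddCommGroup E] {f : Space d → E} (hf : Continuous f) :
    IntegrableOn f (box d L) := by
  have hK : IsCompact (WithLp.toLp 2 '' Set.univ.pi (fun _ : Fin d => Set.Icc 0 L)) :=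
    (isCompact_univ_pi fun _ => isCompact_Icc).image (PiLp.continuous_toLp 2 _)
  refine (hf.continuousOn.integrableOn_compact hK).mono_set fun x hx => ?_
  exact ⟨WithLp.ofLp x, fun i _ => Set.Ioo_subset_Icc_self (hx i), rfl⟩

lemma integral_exp_Ioo (hL : 0 < L) (n : ℤ) :
    ∫ y in Set.Ioo 0 L, Complex.exp (Complex.I * ((2 * Real.pi * (n : ℝ) / L * y : ℝ) : ℂ)) =
      if n = 0 then (L : ℂ) else 0 := by
  rw [← integral_Ioc_eq_integral_Ioo, ← intervalIntegral.integral_of_le hL.le]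
  split_ifs with h
  · simp [h]
  · set c : ℂ := Complex.I * (2 * Real.pi * n / L) with hc
    have hL' : (L : ℂ) ≠ 0 := Complex.ofReal_ne_zero.2 hL.ne'
    have hc0 : c ≠ 0 := by
      have hn : (n : ℂ) ≠ 0 := Int.cast_ne_zero.2 h
      have hpi : (Real.pi : ℂ) ≠ 0 := Complex.ofReal_ne_zero.2 Real.pi_ne_zero
      rw [hc]
      simp [hn, hpi, hL']
    have hf : (fun y : ℝ => Complex.exp (Complex.I * ((2 * Real.pi * (n : ℝ) / L * y : ℝ) : ℂ)))
        = fun y : ℝ => Complex.exp (c * y) := by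
      funext y
      rw [hc]
      push_cast
      ring_nf
    rw [hf, integral_exp_mul_complex hc0]
    have hcL : c * L = n * (2 * Real.pi * Complex.I) := by
      rw [hc]
      field_simp
    rw [hcL, Complex.exp_int_mul_two_pi_mul_I]
    simp

lemma integral_fourierMode (hL : 0 < L) (k : Fin d → ℤ) :
    ∫ x in box d L, fourierMode d L k x = if k = 0 then ((L ^ d : ℝ) : ℂ) else 0 := by
  rw [setIntegral_box, volume_pi, Measure.restrict_pi_pi]
  have h : ∀ y : Fin d → ℝ, fourierMode d L k (WithLp.toLp 2 y) =
      ∏ j, Complex.exp (Complex.I * ((2 * Real.pi * (k j : ℝ) / L * y j : ℝ) : ℂ)) := fun y => by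
    rw [fourierMode, ← Complex.exp_sum, Complex.ofReal_sum, Finset.mul_sum]
  simp only [h]
  rw [integral_fintype_prod_eq_prod (𝕜 := ℂ)
    (f := fun j y => Complex.exp (Complex.I * ((2 * Real.pi * (k j : ℝ) / L * y : ℝ) : ℂ)))]
  simp only [integral_exp_Ioo hL]
  split_ifs with hk
  · simp [hk]
  · obtain ⟨j, hj⟩ := Function.ne_iff.1 hk
    exact Finset.prod_eq_zero (Finset.mem_univ j) (if_neg hj)

lemma fourierMode_mul_conj (k l : Fin d → ℤ) (x : Space d) :
    fourierMode d L k x * starRingEnd ℂ (fourierMode d L l x) = fourierMode d L (k - l) x := by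
  have h : phase L (k - l) x = phase L k x - phase L l x := by
    rw [eq_sub_iff_add_eq, ← phase_add, sub_add_cancel]
  rw [fourierMode_eq, fourierMode_eq, fourierMode_eq, h, ← Complex.exp_conj, ← Complex.exp_add]
  congr 1
  simp
  ring

lemma measureReal_box (hL : 0 < L) : volume.real (box d L) = L ^ d := by
  have h1 : ∫ _ in box d L, (1 : ℂ) = ((L ^ d : ℝ) : ℂ) := by
    have h := integral_fourierMode hL (0 : Fin d → ℤ)
    simpa only [fourierMode_eq, phase_zero, Complex.ofReal_zero, mul_zero, Complex.exp_zero,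
      if_true] using h
  rw [setIntegral_const, Complex.real_smul, mul_one] at h1
  exact_mod_cast h1

lemma setIntegral_box_const (hL : 0 < L) (c : ℝ) : ∫ _ in box d L, c = L ^ d * c := by
  rw [setIntegral_const, measureReal_box hL, smul_eq_mul]

end Box

namespace TrigPoly

variable {d : ℕ} {L : ℝ}

/-- The real part of the `ℓ²` inner product of the coefficients. -/
def coeffForm : LinearMap.BilinForm ℝ (TrigPoly d) :=
  LinearMap.mk₂ ℝ
    (fun a b => ∑ k ∈ a.coeff.support, (a.coeff k * starRingEnd ℂ (b.coeff k)).re)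
    (fun a a' b => by
      classical
      have e : ∀ (a b : TrigPoly d) {s : Finset (Fin d → ℤ)}, a.coeff.support ⊆ s →
          ∑ k ∈ a.coeff.support, (a.coeff k * starRingEnd ℂ (b.coeff k)).re =
          ∑ k ∈ s, (a.coeff k * starRingEnd ℂ (b.coeff k)).re := fun a b s hs =>
        Finset.sum_subset hs fun k _ hk => by simp [Finsupp.notMem_support_iff.1 hk]
      rw [e (a + a') b Finsupp.support_add,
        e a b (s := a.coeff.support ∪ a'.coeff.support) Finset.subset_union_left,
        e a' b (s := a.coeff.support ∪ a'.coeff.support) Finset.subset_union_right,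
        ← Finset.sum_add_distrib]
      refine Finset.sum_congr rfl fun k _ => ?_
      rw [← Complex.add_re, ← add_mul]
      rfl)
    (fun c a b => by
      have hs : (c • a).coeff.support ⊆ a.coeff.support := Finsupp.support_smul
      rw [Finset.sum_subset hs fun k _ hk => by
          rw [Finsupp.notMem_support_iff.1 hk, zero_mul, Complex.zero_re],
        smul_eq_mul, Finset.mul_sum]
      refine Finset.sum_congr rfl fun k _ => ?_
      rw [AddMonoidAlgebra.coeff_smul_apply, Complex.real_smul, mul_assoc, Complex.re_ofReal_mul])
    (fun a b b' => by
      rw [← Finset.sum_add_distrib]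
      refine Finset.sum_congr rfl fun k _ => ?_
      rw [← Complex.add_re, ← mul_add, ← map_add]
      rfl)
    (fun c a b => by
      rw [smul_eq_mul, Finset.mul_sum]
      refine Finset.sum_congr rfl fun k _ => ?_
      rw [AddMonoidAlgebra.coeff_smul_apply, Complex.real_smul, map_mul, Complex.conj_ofReal,
        mul_left_comm, Complex.re_ofReal_mul])

lemma coeffForm_eq_sum (a b : TrigPoly d) {s : Finset (Fin d → ℤ)} (hs : a.coeff.support ⊆ s) :
    coeffForm a b = ∑ k ∈ s, (a.coeff k * starRingEnd ℂ (b.coeff k)).re :=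
  Finset.sum_subset hs fun k _ hk => by simp [Finsupp.notMem_support_iff.1 hk]

lemma coeffForm_comm (a b : TrigPoly d) : coeffForm a b = coeffForm b a := by
  classical
  rw [coeffForm_eq_sum a b (s := a.coeff.support ∪ b.coeff.support) Finset.subset_union_left,
    coeffForm_eq_sum b a (s := a.coeff.support ∪ b.coeff.support) Finset.subset_union_right]
  refine Finset.sum_congr rfl fun k _ => ?_
  simp only [Complex.mul_re, Complex.conj_re, Complex.conj_im]
  ring

lemma coeffForm_self (a : TrigPoly d) : coeffForm a a = weightedSq (fun _ => 1) a := by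
  rw [coeffForm_eq_sum a a subset_rfl, weightedSq]
  refine Finset.sum_congr rfl fun k _ => ?_
  rw [Complex.mul_conj, Complex.ofReal_re, Complex.normSq_eq_norm_sq, one_mul]

lemma coeffForm_self_nonneg (a : TrigPoly d) : 0 ≤ coeffForm a a := by
  rw [coeffForm_self]
  exact weightedSq_nonneg (fun _ => zero_le_one) a

lemma coeffForm_laplace_left (a b : TrigPoly d) :
    coeffForm (laplace L a) b = coeffForm a (laplace L b) := by
  rw [coeffForm_eq_sum (laplace L a) b (support_multiplier _ a),
    coeffForm_eq_sum a (laplace L b) subset_rfl]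
  refine Finset.sum_congr rfl fun k _ => ?_
  rw [laplace, coeff_multiplier, coeff_multiplier, map_mul, Complex.conj_ofReal]
  congr 1
  ring

/-- Parseval's identity. -/
lemma Represents.l2inner_eq (hL : 0 < L) {a b : TrigPoly d} {u v : Space d → ℝ}
    (ha : Represents L a u) (hb : Represents L b v) :
    l2inner d L u v = L ^ d * coeffForm a b := by
  classical
  have h1 : ∀ x, ((u x * v x : ℝ) : ℂ) = ∑ k ∈ a.coeff.support, ∑ l ∈ b.coeff.support,
      (a.coeff k * starRingEnd ℂ (b.coeff l)) * fourierMode d L (k - l) x := fun x => by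
    rw [Complex.ofReal_mul, ← Complex.conj_ofReal (v x), ← ha x, ← hb x, eval_apply, eval_apply,
      map_sum, Finset.sum_mul_sum]
    refine Finset.sum_congr rfl fun k _ => Finset.sum_congr rfl fun l _ => ?_
    rw [map_mul, ← fourierMode_mul_conj]
    ring
  have hint : ∀ k l : Fin d → ℤ, IntegrableOn (fun x =>
      (a.coeff k * starRingEnd ℂ (b.coeff l)) * fourierMode d L (k - l) x) (box d L) :=
    fun k l => integrableOn_box
      (continuous_const.mul (contDiff_fourierMode L (k - l) (n := 0)).continuous)
  have h2 : ((l2inner d L u v : ℝ) : ℂ) =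
      ∑ k ∈ a.coeff.support, ((L ^ d : ℝ) : ℂ) * (a.coeff k * starRingEnd ℂ (b.coeff k)) := by
    rw [l2inner, ← integral_complex_ofReal]
    simp only [h1]
    rw [integral_finsetSum _ fun k _ => integrable_finsetSum _ fun l _ => hint k l]
    refine Finset.sum_congr rfl fun k _ => ?_
    rw [integral_finsetSum _ fun l _ => hint k l]
    simp only [integral_const_mul, integral_fourierMode hL, sub_eq_zero]
    simp only [mul_ite, mul_zero, Finset.sum_ite_eq]
    split_ifs with hk
    · ring
    · simp [Finsupp.notMem_support_iff.1 hk]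
  have h3 := congrArg Complex.re h2
  rw [Complex.ofReal_re, Complex.re_sum] at h3
  rw [h3, coeffForm_eq_sum a b subset_rfl, Finset.mul_sum]
  exact Finset.sum_congr rfl fun k _ => Complex.re_ofReal_mul _ _

lemma Represents.l2normSq_eq (hL : 0 < L) {a : TrigPoly d} {u : Space d → ℝ}
    (ha : Represents L a u) : l2normSq d L u = L ^ d * weightedSq (fun _ => 1) a := by
  rw [← coeffForm_self, ← ha.l2inner_eq hL ha, l2normSq, l2inner]
  simp only [Real.norm_eq_abs, sq_abs, ← sq]

lemma Represents.continuous_grad {a : TrigPoly d} {u : Space d → ℝ}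
    (ha : Represents L a u) : Continuous (CahnHilliard.grad u) := by
  have h : CahnHilliard.grad u = fun x => WithLp.toLp 2 fun j => CahnHilliard.grad u x j := rfl
  rw [h]
  exact (PiLp.continuous_toLp 2 _).comp
    (continuous_pi fun j => ((ha.grad j).contDiff (n := 0)).continuous)

lemma Represents.l2normSq_grad_eq (hL : 0 < L) {a : TrigPoly d} {u : Space d → ℝ}
    (ha : Represents L a u) : l2normSq d L (CahnHilliard.grad u) = L ^ d * weightedSq (freqSq L) a := by
  rw [← sum_weightedSq_partialDeriv, Finset.mul_sum, l2normSq]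
  simp only [EuclideanSpace.norm_sq_eq]
  rw [integral_finsetSum]
  · exact Finset.sum_congr rfl fun j _ => (ha.grad j).l2normSq_eq hL
  · exact fun j _ => integrableOn_box
      (((ha.grad j).contDiff (n := 0)).continuous.norm.pow 2)

end TrigPoly

/-! ### The energy -/

section Energy

variable {d : ℕ} {L ε : ℝ}

lemma l2normSq_nonneg {F : Type*} [NormedAddCommGroup F] (u : Space d → F) :
    0 ≤ l2normSq d L u := integral_nonneg fun _ => sq_nonneg _

lemma energy_nonneg (u : Space d → ℝ) : 0 ≤ energy d L ε u :=
  integral_nonneg fun x => by positivity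

open TrigPoly in
/-- The energy controls the `H¹` norm. -/
lemma h1_le_energy (hL : 0 < L) (hε : 0 < ε) {a : TrigPoly d}
    {u : Space d → ℝ} (ha : TrigPoly.Represents L a u) :
    weightedSq (freqSq L) a ≤ (2 / L ^ d) * energy d L ε u ∧
      weightedSq (fun _ => 1) a ≤ energy d L ε u / L ^ d + (ε ^ 2 + 1) := by
  have hV : 0 < L ^ d := by positivity
  have hcg := ha.continuous_grad
  have hcu : Continuous u := (ha.contDiff (n := 0)).continuous
  have hcE : Continuous fun x => (1 / 2) * ‖grad u x‖ ^ 2 + (u x ^ 2 - 1) ^ 2 / (4 * ε ^ 2) := by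
    fun_prop
  constructor
  · have h1 : l2normSq d L (grad u) ≤ ∫ x in box d L, 2 * ((1 / 2) * ‖grad u x‖ ^ 2 +
        (u x ^ 2 - 1) ^ 2 / (4 * ε ^ 2)) := by
      refine setIntegral_mono (integrableOn_box (hcg.norm.pow 2))
        (integrableOn_box (continuous_const.mul hcE)) fun x => ?_
      have : 0 ≤ (u x ^ 2 - 1) ^ 2 / (4 * ε ^ 2) := by positivity
      dsimp only
      linarith
    rw [integral_const_mul, ha.l2normSq_grad_eq hL] at h1
    change _ ≤ 2 * energy d L ε u at h1
    rw [div_mul_eq_mul_div, le_div_iff₀' hV]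
    exact h1
  · have h1 : l2normSq d L u ≤ ∫ x in box d L, (((1 / 2) * ‖grad u x‖ ^ 2 +
        (u x ^ 2 - 1) ^ 2 / (4 * ε ^ 2)) + (ε ^ 2 + 1)) := by
      refine setIntegral_mono (integrableOn_box (hcu.norm.pow 2))
        (integrableOn_box (hcE.add continuous_const)) fun x => ?_
      -- Young's inequality bounds the `L²` norm by the double-well potential pointwise, so no `L⁴`
      -- norm is needed.
      have h2 : u x ^ 2 - 1 ≤ (u x ^ 2 - 1) ^ 2 / (4 * ε ^ 2) + ε ^ 2 := by
        have := sq_nonneg ((u x ^ 2 - 1) / (2 * ε) - ε)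
        have e : ((u x ^ 2 - 1) / (2 * ε) - ε) ^ 2 =
            (u x ^ 2 - 1) ^ 2 / (4 * ε ^ 2) - (u x ^ 2 - 1) + ε ^ 2 := by
          field_simp
          ring
        linarith
      have : 0 ≤ ‖grad u x‖ ^ 2 := sq_nonneg _
      dsimp only
      rw [Real.norm_eq_abs, sq_abs]
      linarith
    rw [integral_add (integrableOn_box hcE) (integrableOn_box continuous_const),
      setIntegral_box_const hL, ha.l2normSq_eq hL] at h1
    change _ ≤ energy d L ε u + _ at h1
    refine le_of_mul_le_mul_left (h1.trans (le_of_eq ?_)) hV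
    field_simp

end Energy
end CahnHilliard

/-! ### Transfer between the discrete space and coefficients -/

namespace CahnHilliard

open TrigPoly

variable {d : ℕ} {L : ℝ}

/-- The index set of the modes spanning `S_N`. -/
def modes (d N : ℕ) : Set (Fin d → ℤ) := {k | ∀ j, -(N : ℤ) ≤ 2 * k j ∧ 2 * k j ≤ (N : ℤ) - 2}

lemma exists_represents_of_mem_fourierSpace {N : ℕ} {u : Space d → ℝ}
    (hu : u ∈ fourierSpace d L N) :
    ∃ a : TrigPoly d, Represents L a u ∧ (a.coeff.support : Set (Fin d → ℤ)) ⊆ modes d N := by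
  obtain ⟨l, hl, h⟩ := (Finsupp.mem_span_image_iff_linearCombination ℂ).1
    (show (fun x => (u x : ℂ)) ∈ Submodule.span ℂ (fourierMode d L '' modes d N) from hu)
  refine ⟨AddMonoidAlgebra.ofCoeff l, fun x => ?_, hl⟩
  rw [eval_eq_sum, ← congrFun h x, Finsupp.linearCombination_apply]
  rfl

lemma TrigPoly.Represents.mem_fourierSpace {N : ℕ} {a : TrigPoly d} {u : Space d → ℝ}
    (ha : Represents L a u) (hs : (a.coeff.support : Set (Fin d → ℤ)) ⊆ modes d N) :
    u ∈ fourierSpace d L N := by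
  refine (Finsupp.mem_span_image_iff_linearCombination ℂ).2 ⟨a.coeff, hs, ?_⟩
  funext x
  rw [← ha x, eval_eq_sum, Finsupp.linearCombination_apply]
  rfl

section Transfer

variable {t : ℕ → ℝ} {a : ℕ → TrigPoly d} {u : ℕ → Space d → ℝ} {K : ℕ}

lemma represents_bdf2 (h : ∀ n, n ≤ K → Represents L (a n) (u n)) {n : ℕ} (h1 : 1 ≤ n)
    (hn : n ≤ K) : Represents L (bdf2 t a n) (bdf2 t u n) := by
  rw [bdf2_eq t a h1, bdf2_eq t u h1]
  exact (((h n hn).sub (h _ (by omega))).smul _).sub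
    (((h _ (by omega)).sub (h _ (by omega))).smul _)

lemma represents_extrap (h : ∀ n, n ≤ K → Represents L (a n) (u n)) {n : ℕ}
    (hn : n ≤ K) : Represents L (extrap t a n) (extrap t u n) := by
  cases n with
  | zero => exact h 0 hn
  | succ n => exact ((h _ hn).smul _).sub ((h n (by omega)).smul _)

end Transfer

lemma TrigPoly.weightedSq_real_smul (w : (Fin d → ℤ) → ℝ) (c : ℝ) (a : TrigPoly d) :
    weightedSq w (c • a) = c ^ 2 * weightedSq w a := by
  have : c • a = (c : ℂ) • a := by
    ext k
    simp
  rw [this, weightedSq_smul, Complex.norm_real, Real.norm_eq_abs, sq_abs]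

lemma TrigPoly.weightedSq_smul_sub_smul_le {w : (Fin d → ℤ) → ℝ} (hw : ∀ k, 0 ≤ w k) (x y : ℝ)
    (a b : TrigPoly d) : weightedSq w (x • a - y • b) ≤
      2 * x ^ 2 * weightedSq w a + 2 * y ^ 2 * weightedSq w b := by
  have h := weightedSq_add_le hw (x • a) ((-y) • b)
  rw [weightedSq_real_smul, weightedSq_real_smul] at h
  rw [sub_eq_add_neg, ← neg_smul]
  linarith

/-! ### Bounds for the extrapolation -/

section Extrapolation

variable {R δ : ℝ} {K : ℕ} {t : ℕ → ℝ}

lemma weightedSq_extrap_le (hA : StepRatioCond R δ K t) (hδ : 0 < δ) (hδR : δ < R)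
    {w : (Fin d → ℤ) → ℝ} (hw : ∀ k, 0 ≤ w k) (b : ℕ → TrigPoly d) {n : ℕ} (hn : n + 2 ≤ K) :
    weightedSq w (extrap t b (n + 1)) ≤
      2 * (1 + R) ^ 2 * weightedSq w (b (n + 1)) + 2 * R ^ 2 * weightedSq w (b n) := by
  have hr := hA.nonneg hn
  have hr' : ratio t (n + 2) ≤ R := by linarith [hA.le hδR.le hn]
  have h1 := weightedSq_nonneg hw (b (n + 1))
  have h2 := weightedSq_nonneg hw (b n)
  refine (weightedSq_smul_sub_smul_le hw _ _ _ _).trans ?_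
  gcongr

lemma weightedSq_extrap_le_of_forall_le (hA : StepRatioCond R δ K t) (hδ : 0 < δ) (hδR : δ < R)
    {w : (Fin d → ℤ) → ℝ} (hw : ∀ k, 0 ≤ w k) {b : ℕ → TrigPoly d} {m : ℝ}
    (hb : ∀ n, n ≤ K → weightedSq w (b n) ≤ m) {n : ℕ} (hn : n + 1 ≤ K) :
    weightedSq w (extrap t b n) ≤ 4 * (1 + R) ^ 2 * m := by
  have hR : 0 < R := hδ.trans hδR
  have hm : 0 ≤ m := (weightedSq_nonneg hw _).trans (hb 0 (by omega))
  cases n with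
  | zero =>
    refine (hb 0 (by omega)).trans (le_mul_of_one_le_left hm ?_)
    nlinarith
  | succ n =>
    refine (weightedSq_extrap_le hA hδ hδR hw b hn).trans ?_
    calc _ ≤ 2 * (1 + R) ^ 2 * m + 2 * (1 + R) ^ 2 * m := by
            have h1 := hb (n + 1) (by omega)
            have h2 := hb n (by omega)
            have h3 : R ≤ 1 + R := by linarith
            have h4 := weightedSq_nonneg hw (b n)
            gcongr
      _ = _ := by ring

/-- Bounded ratios allow the weight `τ_k` to be moved to the levels `k - 1` and `k - 2` at the cost
of `R` and `R²`, giving the summands `2 (1 + R)² R` and `2 R⁴`; the summand 1 is the first step,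
where the extrapolation is `b 0`. -/
lemma sum_step_mul_weightedSq_extrap_le (ht : IsTimeMesh K t) (hA : StepRatioCond R δ K t)
    (hδ : 0 < δ) (hδR : δ < R) (hR : 1 ≤ R) {w : (Fin d → ℤ) → ℝ} (hw : ∀ k, 0 ≤ w k)
    (b : ℕ → TrigPoly d) {n : ℕ} (h1 : 1 ≤ n) (hn : n ≤ K) :
    ∑ k ∈ Finset.Icc 1 n, step t k * weightedSq w (extrap t b (k - 1)) ≤
      (1 + 2 * (1 + R) ^ 2 * R + 2 * R ^ 4) * (step t 1 * weightedSq w (b 0) +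
        ∑ k ∈ Finset.Icc 1 (n - 1), step t k * weightedSq w (b k)) := by
  have hP : ∀ k, 0 ≤ weightedSq w (b k) := fun k => weightedSq_nonneg hw _
  have hτ : ∀ k, 1 ≤ k → k + 1 ≤ K → step t (k + 1) ≤ R * step t k := fun k hk hkK => by
    have hpos := ht.step_pos hk (by omega)
    have h := (hA.le hδR.le hkK).trans (by linarith : R - δ ≤ R)
    rw [ratio_of_two_le t (by omega), Nat.add_sub_cancel, div_le_iff₀ hpos] at h
    exact h
  -- The extra term on the left is a reserve for the second use of `b n`, as the older level of the
  -- next extrapolation. The maximum is there because `step t 0 = 0`, whereas `b 0` must be charged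
  -- to `τ_1`.
  have key : ∀ n, n + 1 ≤ K →
      ∑ k ∈ Finset.Icc 1 (n + 1), step t k * weightedSq w (extrap t b (k - 1)) +
        2 * R ^ 4 * (step t (max n 1) * weightedSq w (b n)) ≤
      (1 + 2 * (1 + R) ^ 2 * R + 2 * R ^ 4) * (step t 1 * weightedSq w (b 0) +
        ∑ k ∈ Finset.Icc 1 n, step t k * weightedSq w (b k)) := by
    intro n
    induction n with
    | zero =>
      intro hn
      have h0 := mul_nonneg (ht.step_pos le_rfl hn).le (hP 0)
      have : 0 ≤ 2 * (1 + R) ^ 2 * R * (step t 1 * weightedSq w (b 0)) := by positivity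
      simp [extrap]
      linarith
    | succ n ih =>
      intro hn
      have ih := ih (by omega)
      have hT := weightedSq_extrap_le hA hδ hδR hw b hn
      have hs0 := ht.step_pos (by omega : 1 ≤ n + 2) hn
      have hs1 := ht.step_pos (by omega : 1 ≤ n + 1) (by omega)
      have hsm := ht.step_pos (by omega : 1 ≤ max n 1) (by omega)
      have e1 := hτ (n + 1) (by omega) hn
      have e2 : step t (n + 1) ≤ R * step t (max n 1) := by
        rcases Nat.eq_zero_or_pos n with h | h
        · subst h
          exact le_mul_of_one_le_left hsm.le hR
        · rw [max_eq_left h]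
          exact hτ n h (by omega)
      have e3 : step t (n + 2) ≤ R ^ 2 * step t (max n 1) := by nlinarith
      have hT' := mul_le_mul_of_nonneg_left hT hs0.le
      have f1 : step t (n + 2) * (2 * (1 + R) ^ 2 * weightedSq w (b (n + 1))) ≤
          2 * (1 + R) ^ 2 * R * (step t (n + 1) * weightedSq w (b (n + 1))) := by
        calc _ ≤ (R * step t (n + 1)) * (2 * (1 + R) ^ 2 * weightedSq w (b (n + 1))) :=
              mul_le_mul_of_nonneg_right e1 (mul_nonneg (by positivity) (hP _))
          _ = _ := by ring
      have f2 : step t (n + 2) * (2 * R ^ 2 * weightedSq w (b n)) ≤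
          2 * R ^ 4 * (step t (max n 1) * weightedSq w (b n)) := by
        calc _ ≤ (R ^ 2 * step t (max n 1)) * (2 * R ^ 2 * weightedSq w (b n)) :=
              mul_le_mul_of_nonneg_right e3 (mul_nonneg (by positivity) (hP _))
          _ = _ := by ring
      have hX := mul_nonneg hs1.le (hP (n + 1))
      rw [Finset.sum_Icc_succ_top (by omega : 1 ≤ n + 1 + 1),
        Finset.sum_Icc_succ_top (f := fun k => step t k * weightedSq w (b k))
          (by omega : 1 ≤ n + 1), max_eq_left (by omega : 1 ≤ n + 1)]
      change step t (n + 1 + 1) * weightedSq w (extrap t b (n + 1 + 1 - 1)) ≤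
        step t (n + 1 + 1) * _ at hT'
      change step t (n + 1 + 1) * _ ≤ _ at f1
      change step t (n + 1 + 1) * _ ≤ _ at f2
      linarith
  obtain ⟨m, rfl⟩ : ∃ m, n = m + 1 := ⟨n - 1, by omega⟩
  have h := key m hn
  have : 0 ≤ 2 * R ^ 4 * (step t (max m 1) * weightedSq w (b m)) :=
    mul_nonneg (by positivity) (mul_nonneg
      (ht.step_pos (by omega : 1 ≤ max m 1) (by omega)).le (hP _))
  rw [Nat.add_sub_cancel]
  linarith

end Extrapolation

/-! ### A priori bounds from the auxiliary variable -/

section Scheme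

variable {ε : ℝ} {N K : ℕ} {t : ℕ → ℝ} {Φ₀ : Space d → ℝ} {φbar φ : ℕ → Space d → ℝ}
  {γ ξ η : ℕ → ℝ}

lemma IsSchemeSolution.one_le_gamma_zero (h : IsSchemeSolution d L ε N K t Φ₀ φbar φ γ ξ η) :
    1 ≤ γ 0 := by
  rw [h.init_gamma]
  linarith [energy_nonneg (d := d) (L := L) (ε := ε) (φ 0)]

/-- Dissipation of the modified energy. -/
lemma IsSchemeSolution.gamma_pos_le (h : IsSchemeSolution d L ε N K t Φ₀ φbar φ γ ξ η)
    (ht : IsTimeMesh K t) {n : ℕ} (hn : n ≤ K) : 0 < γ n ∧ γ n ≤ γ 0 := by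
  induction n with
  | zero => exact ⟨by linarith [h.one_le_gamma_zero], le_rfl⟩
  | succ n ih =>
    obtain ⟨ih0, ih1⟩ := ih (by omega)
    have hτ := ht.step_pos (by omega : 1 ≤ n + 1) hn
    have hg := h.gamma_eq (n + 1) (by omega) hn
    rw [Nat.add_sub_cancel] at hg
    have hE := energy_nonneg (d := d) (L := L) (ε := ε) (φbar (n + 1))
    have hW := l2normSq_nonneg (d := d) (L := L) (fun x => -grad (lap (φbar (n + 1))) x
      + grad (nonlin ε (extrap t φ n)) x)
    set W := l2normSq d L (fun x => -grad (lap (φbar (n + 1))) x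
      + grad (nonlin ε (extrap t φ n)) x)
    set E := energy d L ε (φbar (n + 1))
    have hE1 : 0 < E + 1 := by linarith
    rw [div_eq_iff hτ.ne'] at hg
    set s := W / (E + 1) * step t (n + 1) with hs
    have hs0 : 0 ≤ s := by positivity
    have hg' : γ (n + 1) * (1 + s) = γ n := by
      have : -(γ (n + 1) / (E + 1)) * W * step t (n + 1) = -(γ (n + 1) * s) := by
        rw [hs]
        ring
      rw [this] at hg
      linarith
    have hpos : 0 < γ (n + 1) := by
      refine pos_of_mul_pos_left ?_ (by linarith : 0 ≤ 1 + s)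
      rw [hg']
      exact ih0
    exact ⟨hpos, by nlinarith⟩

/-- Since `η = ξ (2 - ξ)`, the factor `ξ = γ / (E + 1)` cancels the energy however large it is, and
`0 < ξ ≤ γ 0` bounds the remaining factor. -/
lemma IsSchemeSolution.abs_eta_le (h : IsSchemeSolution d L ε N K t Φ₀ φbar φ γ ξ η)
    (ht : IsTimeMesh K t) {n : ℕ} (h1 : 1 ≤ n) (hn : n ≤ K) :
    |η n| * (energy d L ε (φbar n) + 1) ≤ γ 0 * (2 + γ 0) := by
  obtain ⟨hg, hg0⟩ := h.gamma_pos_le ht hn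
  have hE1 : 1 ≤ energy d L ε (φbar n) + 1 := by
    linarith [energy_nonneg (d := d) (L := L) (ε := ε) (φbar n)]
  have hξ := h.xi_eq n h1 hn
  have hη := h.eta_eq n h1 hn
  set E1 := energy d L ε (φbar n) + 1
  have hξ0 : 0 < ξ n := by rw [hξ]; positivity
  have hξE : ξ n * E1 = γ n := by rw [hξ]; field_simp
  have hξ1 : ξ n ≤ γ 0 := by nlinarith
  have habs : |η n| ≤ ξ n * (2 + γ 0) := by
    have : η n = ξ n * (2 - ξ n) := by rw [hη]; ring
    rw [this, abs_mul, abs_of_pos hξ0]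
    refine mul_le_mul_of_nonneg_left (abs_le.2 ⟨by linarith, by linarith⟩) hξ0.le
  calc |η n| * E1 ≤ ξ n * (2 + γ 0) * E1 := by gcongr
    _ = γ n * (2 + γ 0) := by rw [← hξE]; ring
    _ ≤ γ 0 * (2 + γ 0) := by
      refine mul_le_mul_of_nonneg_right hg0 ?_
      linarith

end Scheme

/-- The square root is at least 1. This lets the constants be expressed through `M` alone. -/
lemma gamma_le_h1Bound {ε γ₀ : ℝ} (hL : 0 < L) (hγ : 1 ≤ γ₀) :
    γ₀ * (2 + γ₀) ≤ h1Bound d L ε γ₀ := by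
  have h1 : 1 ≤ Real.sqrt (1 + ((L ^ d) ^ (1 / 4 : ℝ)) ^ 2 * Real.sqrt (2 * ε ^ 2 + L ^ d)) := by
    rw [Real.one_le_sqrt]
    have : 0 ≤ ((L ^ d) ^ (1 / 4 : ℝ)) ^ 2 * Real.sqrt (2 * ε ^ 2 + L ^ d) := by positivity
    linarith
  have h2 : 0 ≤ γ₀ * (2 + γ₀) := by positivity
  unfold h1Bound
  nlinarith

/-- The `H¹` bound on the coefficients of `η u`, when `|η| (E[u] + 1) ≤ G`. -/
lemma weightedSq_smul_le_of_abs_mul_energy_le {ε : ℝ} (hL : 0 < L) (hε : 0 < ε)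
    {a : TrigPoly d} {u : Space d → ℝ} (ha : Represents L a u) {s G : ℝ}
    (hs : |s| * (energy d L ε u + 1) ≤ G) :
    weightedSq (freqSq L) (s • a) ≤ (2 / L ^ d + ε ^ 2 + 1) * G ^ 2 ∧
      weightedSq (fun _ => 1) (s • a) ≤ (2 / L ^ d + ε ^ 2 + 1) * G ^ 2 := by
  have hV : 0 < L ^ d := by positivity
  obtain ⟨h1, h2⟩ := h1_le_energy hL hε ha
  have hE := energy_nonneg (d := d) (L := L) (ε := ε) u
  set E := energy d L ε u
  set P := 2 / L ^ d + ε ^ 2 + 1 with hP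
  have hV' : 0 < 1 / L ^ d := by positivity
  have e1 : 2 / L ^ d = 2 * (1 / L ^ d) := by ring
  have e2 : E / L ^ d = (1 / L ^ d) * E := by ring
  have hP0 : 0 < P := by positivity
  have hb1 : weightedSq (freqSq L) a ≤ P * (E + 1) := by
    rw [e1] at h1
    rw [hP, e1]
    have : 0 ≤ ε ^ 2 * (E + 1) := by positivity
    nlinarith
  have hb2 : weightedSq (fun _ => 1) a ≤ P * (E + 1) := by
    rw [e2] at h2
    rw [hP, e1]
    have : 0 ≤ ε ^ 2 * E := by positivity
    have : 0 ≤ (1 / L ^ d) * E := by positivity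
    nlinarith
  have hsE : s ^ 2 * (P * (E + 1)) ≤ P * G ^ 2 := by
    have h3 := pow_le_pow_left₀ (by positivity) hs 2
    rw [mul_pow, sq_abs] at h3
    -- The squared norms grow linearly in `E + 1` while `s²` compensates `(E + 1)²`, so there is a
    -- power to spare.
    have h4 : E + 1 ≤ (E + 1) ^ 2 := by nlinarith
    calc s ^ 2 * (P * (E + 1)) = P * (s ^ 2 * (E + 1)) := by ring
      _ ≤ P * (s ^ 2 * (E + 1) ^ 2) := by gcongr
      _ ≤ P * G ^ 2 := by gcongr
  rw [weightedSq_real_smul, weightedSq_real_smul]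
  exact ⟨(mul_le_mul_of_nonneg_left hb1 (sq_nonneg s)).trans hsE,
    (mul_le_mul_of_nonneg_left hb2 (sq_nonneg s)).trans hsE⟩

/-! ### The stability estimate for the scheme -/

section Main

variable {R δ ε : ℝ} {N K : ℕ} {t : ℕ → ℝ} {Φ₀ : Space d → ℝ} {φbar φ : ℕ → Space d → ℝ}
  {γ ξ η : ℕ → ℝ} {α : ℕ → TrigPoly d}

/-- The coefficients of `φ^n`, given those of `φbar^n`. -/
def scaledCoeff (η : ℕ → ℝ) (α : ℕ → TrigPoly d) : ℕ → TrigPoly d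
  | 0 => α 0
  | n + 1 => η (n + 1) • α (n + 1)

lemma IsSchemeSolution.represents_scaledCoeff
    (h : IsSchemeSolution d L ε N K t Φ₀ φbar φ γ ξ η)
    (hα : ∀ n, n ≤ K → Represents L (α n) (φbar n)) {n : ℕ} (hn : n ≤ K) :
    Represents L (scaledCoeff η α n) (φ n) := by
  cases n with
  | zero => rw [h.init_eq]; exact hα 0 hn
  | succ n => rw [h.phi_eq _ (by omega) hn]; exact (hα _ hn).smul _

/-- The `H¹` bound of the scheme. -/
lemma IsSchemeSolution.weightedSq_scaledCoeff_le
    (h : IsSchemeSolution d L ε N K t Φ₀ φbar φ γ ξ η) (ht : IsTimeMesh K t) (hL : 0 < L)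
    (hε : 0 < ε) (hα : ∀ n, n ≤ K → Represents L (α n) (φbar n)) {n : ℕ} (hn : n ≤ K) :
    weightedSq (freqSq L) (scaledCoeff η α n) ≤
        (2 / L ^ d + ε ^ 2 + 1) * h1Bound d L ε (γ 0) ^ 2 ∧
      weightedSq (fun _ => 1) (scaledCoeff η α n) ≤
        (2 / L ^ d + ε ^ 2 + 1) * h1Bound d L ε (γ 0) ^ 2 := by
  have hγ := h.one_le_gamma_zero
  have hM := gamma_le_h1Bound (d := d) (ε := ε) hL hγ
  cases n with
  | zero =>
    have h0 := weightedSq_smul_le_of_abs_mul_energy_le (ε := ε) hL hε (hα 0 hn) (s := 1)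
      (G := h1Bound d L ε (γ 0)) (by
        have := h.init_gamma
        rw [h.init_eq] at this
        rw [abs_one, one_mul, ← this]
        nlinarith)
    rwa [one_smul] at h0
  | succ n =>
    exact weightedSq_smul_le_of_abs_mul_energy_le hL hε (hα _ hn)
      ((h.abs_eta_le ht (by omega) hn).trans hM)

/-- The scheme in terms of coefficients. -/
lemma IsSchemeSolution.coeffForm_eq_zero (h : IsSchemeSolution d L ε N K t Φ₀ φbar φ γ ξ η)
    (hL : 0 < L) (hα : ∀ n, n ≤ K → Represents L (α n) (φbar n)) {n : ℕ} (h1 : 1 ≤ n)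
    (hn : n ≤ K) {b : TrigPoly d} {v : Space d → ℝ} (hb : Represents L b v)
    (hs : (b.coeff.support : Set (Fin d → ℤ)) ⊆ modes d N) :
    coeffForm (bdf2 t α n + laplace L (laplace L (α n)) -
      laplace L (nonlinCoeff ε (extrap t (scaledCoeff η α) (n - 1)))) b = 0 := by
  have hw := h.weak_eq n h1 hn v (hb.mem_fourierSpace hs)
  have hβ : ∀ n, n ≤ K → Represents L (scaledCoeff η α n) (φ n) := fun n hn =>
    h.represents_scaledCoeff hα hn
  rw [(represents_bdf2 hα h1 hn).l2inner_eq hL hb, (hα n hn).lap.lap.l2inner_eq hL hb,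
    (((represents_extrap hβ (by omega : n - 1 ≤ K)).nonlin ε).lap).l2inner_eq hL hb,
    ← mul_add, ← mul_sub] at hw
  rw [LinearMap.BilinForm.sub_left, LinearMap.BilinForm.add_left]
  exact (mul_eq_zero.1 hw).resolve_left (by positivity)

/-- The stability estimate in terms of coefficients, with an arbitrary nonlinear bound. -/
lemma IsSchemeSolution.coeff_stability (h : IsSchemeSolution d L ε N K t Φ₀ φbar φ γ ξ η)
    (hR : R ^ 3 = (2 * R + 1) ^ 2) (hδ : 0 < δ) (hδR : δ < R) (ht : IsTimeMesh K t)
    (hA : StepRatioCond R δ K t) (hL : 0 < L) (hε : 0 < ε)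
    (hα : ∀ n, n ≤ K → Represents L (α n) (φbar n))
    (hs : ∀ n, n ≤ K → ((α n).coeff.support : Set (Fin d → ℤ)) ⊆ modes d N)
    {θ C : ℝ} (hθ : 0 ≤ θ)
    (hC : ∀ a : TrigPoly d,
      weightedSq (fun _ => 1) a ≤
        4 * (1 + R) ^ 2 * ((2 / L ^ d + ε ^ 2 + 1) * h1Bound d L ε (γ 0) ^ 2) →
      weightedSq (freqSq L) a ≤
        4 * (1 + R) ^ 2 * ((2 / L ^ d + ε ^ 2 + 1) * h1Bound d L ε (γ 0) ^ 2) →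
      weightedSq (fun k => freqSq L k ^ 2) (nonlinCoeff ε a) ≤
        θ * weightedSq (fun k => freqSq L k ^ 4) a + C) {n : ℕ} (h1 : 1 ≤ n) (hn : n ≤ K) :
    weightedSq (fun k => freqSq L k ^ 2) (α n) + δ / (72 * (R * (R + 1) ^ 3)) *
        ∑ k ∈ Finset.Icc 1 (n - 1), step t k * weightedSq (fun k => freqSq L k ^ 4) (α k) ≤
      weightedSq (fun k => freqSq L k ^ 2) (α 0) + 4 * (R * (R + 1) ^ 3) / δ *
        (θ * ((1 + 2 * (1 + R) ^ 2 * R + 2 * R ^ 4) *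
          (step t 1 * weightedSq (fun k => freqSq L k ^ 4) (α 0) + (γ 0 * (2 + γ 0)) ^ 2 *
          ∑ k ∈ Finset.Icc 1 (n - 1), step t k * weightedSq (fun k => freqSq L k ^ 4) (α k))) +
          C * t n) := by
  have hR4 := four_lt_of_cube_eq hR
  have hq : 0 < R * (R + 1) ^ 3 := by positivity
  have hlap2 : ∀ a : TrigPoly d, coeffForm (laplace L (laplace L a)) (laplace L (laplace L a)) =
      weightedSq (fun k => freqSq L k ^ 4) a := fun a => by
    rw [coeffForm_self, weightedSq_laplace, weightedSq_laplace]
    congr 1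
    funext k
    ring
  have hlap1 : ∀ a : TrigPoly d, coeffForm (laplace L a) (laplace L a) =
      weightedSq (fun k => freqSq L k ^ 2) a := fun a => by
    rw [coeffForm_self, weightedSq_laplace]
    simp only [one_mul]
  have hstab := bdf2_energy_stability (B := coeffForm) hR coeffForm_comm coeffForm_self_nonneg hδ
    hδR ht hA (u := α) (S := fun n => laplace L (laplace L (α n)))
    (F := fun n => laplace L (nonlinCoeff ε (extrap t (scaledCoeff η α) (n - 1))))
    (w := fun n => laplace L (α n))
    -- Both test functions, the increment and the bilaplacian, are admissible: subtraction and
    -- multipliers create no modes outside `S_N`.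
    (fun n h1 hn => h.coeffForm_eq_zero hL hα h1 hn ((hα n hn).sub (hα (n - 1) (by omega)))
      fun k hk => (Finset.mem_union.1 (Finsupp.support_sub hk)).elim
        (fun hk => hs n hn hk) (fun hk => hs (n - 1) (by omega) hk))
    (fun n h1 hn => h.coeffForm_eq_zero hL hα h1 hn (hα n hn).lap.lap
      fun k hk => hs n hn (support_multiplier _ _ (support_multiplier _ _ hk)))
    (fun n h1 hn => by
      have hsq := coeffForm_self_nonneg
        ((1 : ℝ) • laplace L (α n) - (1 : ℝ) • laplace L (α (n - 1)))
      rw [bilin_sub_smul_self coeffForm_comm] at hsq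
      have h1 := coeffForm_laplace_left (L := L) (laplace L (α n)) (α n)
      have h2 := coeffForm_laplace_left (L := L) (laplace L (α n)) (α (n - 1))
      rw [map_sub]
      linarith) hn
  simp only [hlap2, hlap1] at hstab
  have hfreq4 : ∀ k : Fin d → ℤ, 0 ≤ freqSq L k ^ 4 := fun k => pow_nonneg (freqSq_nonneg L k) 4
  have hH1 : ∀ n, n ≤ K → _ := fun n hn => h.weightedSq_scaledCoeff_le ht hL hε hα (n := n) hn
  have hF : ∑ k ∈ Finset.Icc 1 n, step t k * weightedSq (fun k => freqSq L k ^ 2)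
      (nonlinCoeff ε (extrap t (scaledCoeff η α) (k - 1))) ≤
      θ * ∑ k ∈ Finset.Icc 1 n, step t k * weightedSq (fun k => freqSq L k ^ 4)
        (extrap t (scaledCoeff η α) (k - 1)) + C * t n := by
    rw [← ht.sum_step n, Finset.mul_sum, Finset.mul_sum, ← Finset.sum_add_distrib]
    refine Finset.sum_le_sum fun k hk => ?_
    obtain ⟨hk1, hkn⟩ := Finset.mem_Icc.1 hk
    have hb := hC (extrap t (scaledCoeff η α) (k - 1))
      (weightedSq_extrap_le_of_forall_le hA hδ hδR (fun _ => zero_le_one)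
        (fun n hn => (hH1 n hn).2) (by omega))
      (weightedSq_extrap_le_of_forall_le hA hδ hδR (freqSq_nonneg L)
        (fun n hn => (hH1 n hn).1) (by omega))
    have := mul_le_mul_of_nonneg_left hb (ht.step_pos hk1 (by omega)).le
    linarith
  have hext := sum_step_mul_weightedSq_extrap_le ht hA hδ hδR (by linarith) hfreq4
    (scaledCoeff η α) h1 hn
  -- Only levels `k ≥ 1` carry `η`; level zero, where `φ = φbar`, is kept separate without the
  -- factor.
  have hscaled : ∑ k ∈ Finset.Icc 1 (n - 1),
      step t k * weightedSq (fun k => freqSq L k ^ 4) (scaledCoeff η α k) ≤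
      (γ 0 * (2 + γ 0)) ^ 2 * ∑ k ∈ Finset.Icc 1 (n - 1),
        step t k * weightedSq (fun k => freqSq L k ^ 4) (α k) := by
    rw [Finset.mul_sum]
    refine Finset.sum_le_sum fun k hk => ?_
    obtain ⟨hk1, hkn⟩ := Finset.mem_Icc.1 hk
    obtain ⟨j, rfl⟩ : ∃ j, k = j + 1 := ⟨k - 1, by omega⟩
    have hη : |η (j + 1)| ≤ γ 0 * (2 + γ 0) := by
      refine le_trans (le_mul_of_one_le_right (abs_nonneg _) ?_)
        (h.abs_eta_le ht hk1 (by omega : j + 1 ≤ K))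
      linarith [energy_nonneg (d := d) (L := L) (ε := ε) (φbar (j + 1))]
    have hη2 := pow_le_pow_left₀ (abs_nonneg _) hη 2
    rw [sq_abs] at hη2
    have := mul_le_mul_of_nonneg_right hη2 (mul_nonneg (ht.step_pos hk1 (by omega : j + 1 ≤ K)).le
      (weightedSq_nonneg hfreq4 (α (j + 1))))
    rw [scaledCoeff, weightedSq_real_smul]
    linarith
  -- The term `k = n` on the left is discarded to match the forcing sum, which ends at `n - 1`.
  have hsum_le : ∑ k ∈ Finset.Icc 1 (n - 1),
      step t k * weightedSq (fun k => freqSq L k ^ 4) (α k) ≤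
      ∑ k ∈ Finset.Icc 1 n, step t k * weightedSq (fun k => freqSq L k ^ 4) (α k) :=
    Finset.sum_le_sum_of_subset_of_nonneg (Finset.Icc_subset_Icc_right (by omega))
      fun k hk _ => mul_nonneg (ht.step_pos (Finset.mem_Icc.1 hk).1
        ((Finset.mem_Icc.1 hk).2.trans hn)).le (weightedSq_nonneg hfreq4 _)
  refine (add_le_add_right (mul_le_mul_of_nonneg_left hsum_le (by positivity)) _).trans
    (hstab.trans (add_le_add_right (mul_le_mul_of_nonneg_left (hF.trans
      (add_le_add_left (mul_le_mul_of_nonneg_left (hext.trans ?_) hθ) _)) (by positivity)) _))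
  exact mul_le_mul_of_nonneg_left (add_le_add_right hscaled _) (by positivity)

end Main

end CahnHilliard

end

/-! ### Choice of constants and conclusion -/

open CahnHilliard
theorem theorem3p2 (rmax : ℝ) (hrmax : rmax ^ 3 = (2 * rmax + 1) ^ 2) :
    ∃ c : ℝ → ℝ, (∀ δ : ℝ, 0 < δ → δ < rmax → 0 < c δ) ∧
      ∀ (d : ℕ), d = 2 ∨ d = 3 → ∀ (L ε : ℝ), 0 < L → 0 < ε →
        ∃ C : ℝ → ℝ → ℝ, (∀ e M : ℝ, 0 < C e M) ∧
          ∀ (δ : ℝ), 0 < δ → δ < rmax →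
          ∀ (N K : ℕ) (t : ℕ → ℝ), IsTimeMesh K t → StepRatioCond rmax δ K t →
          ∀ (Φ₀ : Space d → ℝ), MemLp Φ₀ 2 (volume.restrict (box d L)) →
          ∀ (φbar φ : ℕ → Space d → ℝ) (γ ξ η : ℕ → ℝ),
            IsSchemeSolution d L ε N K t Φ₀ φbar φ γ ξ η →
          ∀ (e : ℝ), 0 < e → ∀ (n : ℕ), 1 ≤ n → n ≤ K →
            l2normSq d L (lap (φbar n))
                + (c δ / 2 - 40 * e * constC1 rmax (γ 0) / δ) *
                  ∑ k ∈ Finset.Icc 1 (n - 1), step t k * l2normSq d L (lap (lap (φbar k)))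
              ≤ l2normSq d L (lap (φbar 0))
                + 80 * (1 + rmax) ^ 3 * e * step t 1 / δ * l2normSq d L (lap (lap (φ 0)))
                + C e (h1Bound d L ε (γ 0)) * t n / δ := by
  have hR4 := four_lt_of_cube_eq hrmax
  have hR0 : 0 < rmax := by linarith
  set q : ℝ := rmax * (rmax + 1) ^ 3 with hq
  have hq0 : 0 < q := by positivity
  set A : ℝ := 1 + 2 * (1 + rmax) ^ 2 * rmax + 2 * rmax ^ 4 with hAdef
  have hA0 : 0 < A := by positivity
  refine ⟨fun δ => δ / (36 * q), fun δ hδ _ => by positivity, fun d hd L ε hL hε => ?_⟩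
  have hV : 0 < L ^ d := by positivity
  -- Chosen so that the prefactor `4q / δ` times `κ e` times the extrapolation constant `A` equals
  -- `80 (1 + rmax)³ e / δ`.
  set κ : ℝ := 20 * (1 + rmax) ^ 3 / (q * A) with hκ
  have hκ0 : 0 < κ := by positivity
  have hex : ∀ e M : ℝ, ∃ C : ℝ, 0 < C ∧ (0 < e → 0 < M → ∀ a : TrigPoly d,
      TrigPoly.weightedSq (fun _ => 1) a ≤
        4 * (1 + rmax) ^ 2 * ((2 / L ^ d + ε ^ 2 + 1) * M ^ 2) →
      TrigPoly.weightedSq (freqSq L) a ≤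
        4 * (1 + rmax) ^ 2 * ((2 / L ^ d + ε ^ 2 + 1) * M ^ 2) →
      TrigPoly.weightedSq (fun k => freqSq L k ^ 2) (TrigPoly.nonlinCoeff ε a) ≤
        κ * e * TrigPoly.weightedSq (fun k => freqSq L k ^ 4) a + C) := fun e M => by
    by_cases h : 0 < e ∧ 0 < M
    · obtain ⟨he, hM⟩ := h
      obtain ⟨C, hC, h⟩ := TrigPoly.exists_weightedSq_nonlinCoeff_le (d := d) (by omega) hL ε
        (mul_pos hκ0 he)
        (by positivity : 0 < 4 * (1 + rmax) ^ 2 * ((2 / L ^ d + ε ^ 2 + 1) * M ^ 2))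
      exact ⟨C, hC, fun _ _ => h⟩
    · exact ⟨1, one_pos, fun he hM => absurd ⟨he, hM⟩ h⟩
  choose C hC0 hC using hex
  refine ⟨fun e M => 4 * q * L ^ d * C e M, fun e M => by have := hC0 e M; positivity, ?_⟩
  intro δ hδ hδR N K t ht hA Φ₀ _ φbar φ γ ξ η h e he n h1 hn
  have hγ := h.one_le_gamma_zero
  have hM := (by positivity : 0 < γ 0 * (2 + γ 0)).trans_le
    (gamma_le_h1Bound (d := d) (ε := ε) hL hγ)
  have hrep : ∀ n, ∃ a : TrigPoly d, n ≤ K → TrigPoly.Represents L a (φbar n) ∧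
      (a.coeff.support : Set (Fin d → ℤ)) ⊆ modes d N := fun n => by
    by_cases hn : n ≤ K
    · obtain ⟨a, ha⟩ := exists_represents_of_mem_fourierSpace (h.mem n hn)
      exact ⟨a, fun _ => ha⟩
    · exact ⟨0, fun hn' => absurd hn' hn⟩
  choose α hα using hrep
  have key := h.coeff_stability hrmax hδ hδR ht hA hL hε (fun n hn => (hα n hn).1)
    (fun n hn => (hα n hn).2) (mul_pos hκ0 he).le (hC e _ he hM) h1 hn
  have hN1 : ∀ k, k ≤ K → l2normSq d L (lap (φbar k)) =
      L ^ d * TrigPoly.weightedSq (fun k => freqSq L k ^ 2) (α k) := fun k hk => by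
    rw [(hα k hk).1.lap.l2normSq_eq hL, TrigPoly.weightedSq_laplace]
    simp only [one_mul]
  have hN2 : ∀ k, k ≤ K → l2normSq d L (lap (lap (φbar k))) =
      L ^ d * TrigPoly.weightedSq (fun k => freqSq L k ^ 4) (α k) := fun k hk => by
    rw [(hα k hk).1.lap.lap.l2normSq_eq hL, TrigPoly.weightedSq_laplace,
      TrigPoly.weightedSq_laplace]
    congr 2
    funext k
    ring
  have hsum : ∑ k ∈ Finset.Icc 1 (n - 1), step t k * l2normSq d L (lap (lap (φbar k))) =
      L ^ d * ∑ k ∈ Finset.Icc 1 (n - 1),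
        step t k * TrigPoly.weightedSq (fun k => freqSq L k ^ 4) (α k) := by
    rw [Finset.mul_sum]
    refine Finset.sum_congr rfl fun k hk => ?_
    rw [hN2 k (by have := (Finset.mem_Icc.1 hk).2; omega)]
    ring
  rw [h.init_eq, hN1 n hn, hN1 0 (by omega), hN2 0 (by omega), hsum]
  have hS0 : 0 ≤ ∑ k ∈ Finset.Icc 1 (n - 1),
      step t k * TrigPoly.weightedSq (fun k => freqSq L k ^ 4) (α k) :=
    Finset.sum_nonneg fun k hk => mul_nonneg (ht.step_pos (Finset.mem_Icc.1 hk).1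
      (by have := (Finset.mem_Icc.1 hk).2; omega)).le
      (TrigPoly.weightedSq_nonneg (fun k => pow_nonneg (freqSq_nonneg L k) 4) _)
  set S := ∑ k ∈ Finset.Icc 1 (n - 1),
    step t k * TrigPoly.weightedSq (fun k => freqSq L k ^ 4) (α k)
  set Q := TrigPoly.weightedSq (fun k => freqSq L k ^ 4) (α 0)
  set W := TrigPoly.weightedSq (fun k => freqSq L k ^ 2) (α n)
  set W0 := TrigPoly.weightedSq (fun k => freqSq L k ^ 2) (α 0)
  set G := γ 0 * (2 + γ 0) with hG
  have hkey : W + δ / (72 * q) * S ≤ W0 + 80 * (1 + rmax) ^ 3 * e / δ * (step t 1 * Q + G ^ 2 * S)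
      + 4 * q * C e (h1Bound d L ε (γ 0)) * t n / δ := by
    refine key.trans (le_of_eq ?_)
    rw [hκ]
    field_simp
    ring
  have hc1 : 40 * e * constC1 rmax (γ 0) / δ * S =
      80 * (1 + rmax) ^ 3 * e / δ * (rmax * (G ^ 2 * S)) := by
    rw [constC1, hG]
    ring
  -- The constant `c₁` contains one more factor `rmax` than the estimate produces; it is harmless
  -- because `rmax ≥ 1`.
  have hle : 80 * (1 + rmax) ^ 3 * e / δ * (G ^ 2 * S) ≤
      80 * (1 + rmax) ^ 3 * e / δ * (rmax * (G ^ 2 * S)) := by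
    refine mul_le_mul_of_nonneg_left (le_mul_of_one_le_left (by positivity) (by linarith))
      (by positivity)
  have hfin := mul_le_mul_of_nonneg_left
    (show W + (δ / (72 * q) * S - 40 * e * constC1 rmax (γ 0) / δ * S) ≤
      W0 + 80 * (1 + rmax) ^ 3 * e / δ * (step t 1 * Q) +
        4 * q * C e (h1Bound d L ε (γ 0)) * t n / δ by
      rw [hc1]
      linarith) hV.le
  refine le_trans (le_of_eq ?_) (hfin.trans (le_of_eq ?_))
  · have : δ / (36 * q) / 2 = δ / (72 * q) := by
      field_simp
      norm_num
    dsimp only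
    rw [this]
    ring
  · dsimp only
    ring
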